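/- Let $n,p,r$ be integers with $1\le r\le n-5$ and $r<p$. Let $X_1,\dots,X_n$ be independent and identically distributed from the $p$-dimensional normal distribution $N_p(\mu,\Sigma)$, where $\mu\in\mathbb{R}^p$ and the positive semidefinite matrix $\Sigma$ of rank $r$ are unknown. Let $\bar X=\frac1n\sum_{k=1}^n X_k$ and $S=\frac1n\sum_{k=1}^n (X_k-\bar X)(X_k-\bar X)^t$, and write $A^+$ for the Moore-Penrose pseudoinverse of a matrix $A$, and $\|\cdot\|_F$ for the Frobenius norm. The risk of an estimator $\hat\Sigma^+$ of $\Sigma^+$ is $\mathrm{E}\|\hat\Sigma^+-\Sigma^+\|_F^2$. One estimator dominates another if its risk is at most that of the other for all $(\mu,\Sigma)$ as above, and strictly smaller for at least one $(\mu,\Sigma)$. For all such $(\mu,\Sigma)$, the risk of $aS^+$ is finite for every $a\in\mathbb{R}$, $\mathrm{E}\,\mathrm{tr}\big((S^+)^2\big)<\infty$, and for every real $a\le\frac{n-r-2}{n}$ \[ \mathrm{E}\|aS^+-\Sigma^+\|_F^2\le \mathrm{E}\Big\|\frac{n-r-2}{n}S^+-\Sigma^+\Big\|_F^2+\Big(a-\frac{n-r-2}{n}\Big)\Big(a-\frac{n-r-6}{n}\Big)\,\mathrm{E}\,\mathrm{tr}\big((S^+)^2\big).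 \] The right-hand side, as a function of $a\in\mathbb{R}$, has the unique minimizer $a=\frac{n-r-4}{n}$. The estimator $\frac{n-r-4}{n}S^+$ dominates $\frac{n-r-2}{n}S^+$, which in turn dominates $S^+$. -/

import Mathlib

open MeasureTheory ProbabilityTheory
open scoped Matrix ENNReal

noncomputable section

namespace SingularPrecision

/-- The four Penrose conditions: `B` is the Moore-Penrose pseudoinverse of the real matrix `A`. -/
structure IsMoorePenrose {m k : Type*} [Fintype m] [Fintype k]
    (A : Matrix m k ℝ) (B : Matrix k m ℝ) : Prop where
  mul_mul_self : A * B * A = A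
  self_mul_mul : B * A * B = B
  symm_left : (A * B)ᵀ = A * B
  symm_right : (B * A)ᵀ = B * A

theorem IsMoorePenrose.unique {m k : Type*} [Fintype m] [Fintype k]
    {A : Matrix m k ℝ} {B C : Matrix k m ℝ}
    (hB : IsMoorePenrose A B) (hC : IsMoorePenrose A C) : B = C := by
  have h1 : A * B = A * C := by
    calc A * B = (A * B)ᵀ := hB.symm_left.symm
      _ = ((A * C * A) * B)ᵀ := by rw [hC.mul_mul_self]
      _ = ((A * C) * (A * B))ᵀ := by simp only [Matrix.mul_assoc]
      _ = (A * B) * (A * C) := by rw [Matrix.transpose_mul, hB.symm_left, hC.symm_left]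
      _ = A * B * A * C := by simp only [Matrix.mul_assoc]
      _ = A * C := by rw [hB.mul_mul_self]
  have h2 : B * A = C * A := by
    calc B * A = (B * A)ᵀ := hB.symm_right.symm
      _ = (B * (A * C * A))ᵀ := by rw [hC.mul_mul_self]
      _ = ((B * A) * (C * A))ᵀ := by simp only [Matrix.mul_assoc]
      _ = (C * A) * (B * A) := by rw [Matrix.transpose_mul, hB.symm_right, hC.symm_right]
      _ = C * (A * B * A) := by simp only [Matrix.mul_assoc]
      _ = C * A := by rw [hB.mul_mul_self]
  calc B = B * A * B := hB.self_mul_mul.symm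
    _ = C * A * B := by rw [h2]
    _ = C * (A * B) := Matrix.mul_assoc _ _ _
    _ = C * A * C := by rw [h1, Matrix.mul_assoc]
    _ = C := hC.self_mul_mul

theorem exists_isMoorePenrose_of_isHermitian {k : Type*} [Fintype k] [DecidableEq k]
    {H : Matrix k k ℝ} (hH : H.IsHermitian) :
    ∃ G : Matrix k k ℝ, IsMoorePenrose H G ∧ Gᵀ = G := by
  obtain ⟨U, d, hU, hHU⟩ : ∃ (U : Matrix k k ℝ) (d : k → ℝ), Uᵀ * U = 1 ∧
      H = U * Matrix.diagonal d * Uᵀ := by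
    refine ⟨hH.eigenvectorUnitary, hH.eigenvalues, ?_, ?_⟩
    · have := Unitary.coe_star_mul_self hH.eigenvectorUnitary
      simpa [Matrix.star_eq_conjTranspose, Matrix.conjTranspose_eq_transpose_of_trivial] using this
    · have := hH.spectral_theorem
      rw [Unitary.conjStarAlgAut_apply] at this
      simpa [Matrix.star_eq_conjTranspose, Matrix.conjTranspose_eq_transpose_of_trivial,
        Function.comp_def] using this
  have key : ∀ e f : k → ℝ, (U * Matrix.diagonal e * Uᵀ) * (U * Matrix.diagonal f * Uᵀ)
      = U * Matrix.diagonal (fun i => e i * f i) * Uᵀ := by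
    intro e f
    calc (U * Matrix.diagonal e * Uᵀ) * (U * Matrix.diagonal f * Uᵀ)
        = U * Matrix.diagonal e * (Uᵀ * U) * Matrix.diagonal f * Uᵀ := by
          simp only [Matrix.mul_assoc]
      _ = U * Matrix.diagonal (fun i => e i * f i) * Uᵀ := by
          rw [hU, Matrix.mul_one, Matrix.mul_assoc U, Matrix.diagonal_mul_diagonal]
  have keyT : ∀ e : k → ℝ, (U * Matrix.diagonal e * Uᵀ)ᵀ = U * Matrix.diagonal e * Uᵀ := by
    intro e
    simp [Matrix.transpose_mul, Matrix.mul_assoc]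
  refine ⟨U * Matrix.diagonal (fun i => (d i)⁻¹) * Uᵀ, ⟨?_, ?_, ?_, ?_⟩, keyT _⟩
  · simp [hHU, key]
  · rw [hHU, key, key]
    congr 3
    funext i
    by_cases h : d i = 0 <;> simp [h]
  · rw [hHU, key, keyT]
  · rw [hHU, key, keyT]

theorem exists_isMoorePenrose {m k : Type*} [Fintype m] [Fintype k]
    (A : Matrix m k ℝ) : ∃ B : Matrix k m ℝ, IsMoorePenrose A B := by
  classical
  have hH : (Aᵀ * A).IsHermitian := by
    have := Matrix.isHermitian_conjTranspose_mul_self A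
    rwa [Matrix.conjTranspose_eq_transpose_of_trivial] at this
  obtain ⟨G, hG, hGt⟩ := exists_isMoorePenrose_of_isHermitian hH
  have hA : A * G * (Aᵀ * A) = A := by
    have hz : (A * G * (Aᵀ * A) - A)ᵀ * (A * G * (Aᵀ * A) - A) = 0 := by
      have h0 : Aᵀ * (A * G * (Aᵀ * A) - A) = 0 := by
        have h := hG.mul_mul_self
        rw [Matrix.mul_sub, sub_eq_zero]
        simpa only [Matrix.mul_assoc] using h
      have h1 : (A * G * (Aᵀ * A) - A)ᵀ = (Aᵀ * A * G - 1) * Aᵀ := by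
        simp [Matrix.transpose_sub, Matrix.transpose_mul, hGt, Matrix.sub_mul, Matrix.mul_assoc]
      rw [h1, Matrix.mul_assoc, h0, Matrix.mul_zero]
    rw [← Matrix.conjTranspose_eq_transpose_of_trivial,
      Matrix.conjTranspose_mul_self_eq_zero, sub_eq_zero] at hz
    exact hz
  refine ⟨G * Aᵀ, ⟨?_, ?_, ?_, ?_⟩⟩
  · simpa only [Matrix.mul_assoc] using hA
  · have h := congrArg (fun M => M * Aᵀ) hG.self_mul_mul
    simpa only [Matrix.mul_assoc] using h
  · simp [Matrix.transpose_mul, hGt, Matrix.mul_assoc]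
  · have h := hG.symm_right
    simpa only [Matrix.mul_assoc] using h

/-- The Moore-Penrose pseudoinverse `A⁺` of a real matrix. -/
def pinv {m k : Type*} [Fintype m] [Fintype k] (A : Matrix m k ℝ) : Matrix k m ℝ :=
  (exists_isMoorePenrose A).choose

theorem pinv_spec {m k : Type*} [Fintype m] [Fintype k] (A : Matrix m k ℝ) :
    IsMoorePenrose A (pinv A) :=
  (exists_isMoorePenrose A).choose_spec

/-- A sample of `n` observations in `ℝᵖ`. -/
abbrev Sample (n p : ℕ) : Type := Fin n → EuclideanSpace ℝ (Fin p)

/-- The joint law of an i.i.d. sample of size `n` from `N_p(μ, V)`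
(for a positive semidefinite, possibly singular `V`). -/
def sampleLaw (n : ℕ) {p : ℕ} (μ : EuclideanSpace ℝ (Fin p)) (V : Matrix (Fin p) (Fin p) ℝ) :
    Measure (Sample n p) :=
  Measure.pi fun _ : Fin n => multivariateGaussian μ V

/-- The sample mean. -/
def sampleMean {n p : ℕ} (x : Sample n p) : EuclideanSpace ℝ (Fin p) :=
  (n : ℝ)⁻¹ • ∑ k, x k

/-- The centered `n × p` data matrix, with rows `X_k - X̄`. -/
def centered {n p : ℕ} (x : Sample n p) : Matrix (Fin n) (Fin p) ℝ :=
  Matrix.of fun k i => x k i - sampleMean x i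

/-- The sample covariance matrix `S`, normalized by `1 / n`. -/
def sampleCov {n p : ℕ} (x : Sample n p) : Matrix (Fin p) (Fin p) ℝ :=
  (n : ℝ)⁻¹ • ((centered x)ᵀ * centered x)

section Frobenius

attribute [local instance] Matrix.frobeniusNormedAddCommGroup

/-- The Frobenius loss `‖A - B‖_F²`. -/
def frobeniusLoss {p : ℕ} (A B : Matrix (Fin p) (Fin p) ℝ) : ℝ := ‖A - B‖ ^ 2

theorem frobeniusLoss_eq_sum {p : ℕ} (A B : Matrix (Fin p) (Fin p) ℝ) :
    frobeniusLoss A B = ∑ i, ∑ j, (A i j - B i j) ^ 2 := by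
  rw [frobeniusLoss, Matrix.frobenius_norm_def, ← Real.sqrt_eq_rpow, Real.sq_sqrt]
  · simp
  · positivity

end Frobenius

/-- The risk `E ‖δ(X) - V⁺‖_F² ∈ [0, ∞]` of an estimator `δ` of the precision matrix `V⁺`
when the sample is drawn from `N_p(μ, V)`. -/
def risk {n p : ℕ} (δ : Sample n p → Matrix (Fin p) (Fin p) ℝ)
    (μ : EuclideanSpace ℝ (Fin p)) (V : Matrix (Fin p) (Fin p) ℝ) : ℝ≥0∞ :=
  ∫⁻ x, ENNReal.ofReal (frobeniusLoss (δ x) (pinv V)) ∂(sampleLaw n μ V)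

/-- The covariance matrices of the model: positive semidefinite of rank `r`. -/
def IsModelCov {p : ℕ} (r : ℕ) (V : Matrix (Fin p) (Fin p) ℝ) : Prop :=
  V.PosSemidef ∧ V.rank = r

/-- `δ` dominates `δ'` over the model with covariance of rank `r`: its risk is never larger,
and is strictly smaller for at least one value of the parameter `(μ, V)`. -/
def Dominates {n p : ℕ} (r : ℕ) (δ δ' : Sample n p → Matrix (Fin p) (Fin p) ℝ) : Prop :=
  (∀ μ V, IsModelCov r V → risk δ μ V ≤ risk δ' μ V) ∧
  (∃ μ V, IsModelCov r V ∧ risk δ μ V < risk δ' μ V)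

/-- The estimator `a S⁺`. -/
def scaledPinv {n p : ℕ} (a : ℝ) (x : Sample n p) : Matrix (Fin p) (Fin p) ℝ :=
  a • pinv (sampleCov x)

/-- The upper bound on the risk of `a S⁺`, as a function of `a`. -/
def riskBound (n : ℕ) {p : ℕ} (r : ℕ) (μ : EuclideanSpace ℝ (Fin p))
    (V : Matrix (Fin p) (Fin p) ℝ) (a : ℝ) : ℝ :=
  (risk (n := n) (scaledPinv (((n : ℝ) - r - 2) / n)) μ V).toReal
    + (a - ((n : ℝ) - r - 2) / n) * (a - ((n : ℝ) - r - 6) / n)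
      * ∫ x, (pinv (sampleCov x) ^ 2).trace ∂(sampleLaw n μ V)

end SingularPrecision

end

open Module Set Filter Topology
open scoped RealInnerProductSpace

/-! The singular problem reduces to a nonsingular one in dimension `r`. Write `V = B Bᵀ` with `B` of
size `p × r`, and take `C` with `Cᵀ B = 1`, `B Cᵀ` symmetric and `Cᵀ C = diag d`, where the `d i`
are the inverse nonzero eigenvalues of `V`. Then `V⁺ = C Cᵀ`, and almost surely `S⁺ = n C W⁻¹ Cᵀ`,
where `W` is distributed as the Gram matrix of `r` independent standard Gaussian vectors in the `(n
- 1)`-dimensional space of centered vectors (`ae_sampleLaw_pinv`, `identDistrib_inv_scatter`). The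
loss of `a S⁺` becomes a weighted sum of `(a n W⁻¹ i j - δ i j)²` with weights `d i * d j`.

The entry `W⁻¹ i i` is the inverse squared distance from one vector to the span of the others
(`inv_gram_apply_self`), hence an inverse chi-square with `n - r` degrees of freedom. Its first two
moments are `1/(n-r-2)` and `1/((n-r-2)(n-r-4))`; the second is finite because `n - r ≥ 5`.
Off-diagonal entries need only be square integrable: they enter the risk through `T = E tr (S⁺)²`
alone, and dropping them bounds `T` from below.

With `c = (n-r-2)/n`, `e = 1/n`, `τ = tr (V⁺)²` and `q = τ/c`, the risk is `a² T - 2 a q + c q` with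
`q ≤ (c - 2e) T`. All the claims follow from this quadratic and this single inequality. -/

namespace SingularPrecision

/-! ### Standard Gaussian vectors and the inverse moments of their squared norm. -/

section StdGaussian

variable {E F : Type*} [NormedAddCommGroup E] [InnerProductSpace ℝ E] [FiniteDimensional ℝ E]
  [MeasurableSpace E] [BorelSpace E] [NormedAddCommGroup F] [InnerProductSpace ℝ F]
  [FiniteDimensional ℝ F] [MeasurableSpace F] [BorelSpace F]

/-- The image of a standard Gaussian under a linear map whose adjoint is isometric is a standard
Gaussian. -/
theorem stdGaussian_map_of_adjoint {L : E → F} (hLm : Measurable L) (M : F → E)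
    (hLM : ∀ x t, ⟪L x, t⟫ = ⟪x, M t⟫) (hM : ∀ t, ‖M t‖ = ‖t‖) :
    (stdGaussian E).map L = stdGaussian F := by
  have : IsProbabilityMeasure ((stdGaussian E).map L) :=
    Measure.isProbabilityMeasure_map hLm.aemeasurable
  apply Measure.ext_of_charFun
  ext t
  rw [charFun_stdGaussian, charFun_apply, integral_map hLm.aemeasurable (by fun_prop)]
  simp_rw [hLM]
  rw [← charFun_apply, charFun_stdGaussian, hM]

theorem stdGaussian_real : stdGaussian ℝ = gaussianReal 0 1 := by
  apply Measure.ext_of_charFun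
  ext t
  rw [charFun_stdGaussian, charFun_gaussianReal]
  congr 1
  rw [← Complex.ofReal_pow, Real.norm_eq_abs, sq_abs]
  push_cast
  ring

/-- The coordinate along a unit normal to `L` is a standard real Gaussian, which has no atom at `0`.
-/
theorem stdGaussian_submodule_eq_zero {L : Submodule ℝ E} (hL : L ≠ ⊤) :
    stdGaussian E (L : Set E) = 0 := by
  have hL' : Lᗮ ≠ ⊥ := fun h => hL ((Submodule.orthogonal_eq_bot_iff).1 h)
  obtain ⟨v, hv, hv0⟩ := Submodule.exists_mem_ne_zero_of_ne_bot hL'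
  set u : E := (‖v‖)⁻¹ • v with hu
  have hu1 : ‖u‖ = 1 := norm_smul_inv_norm (𝕜 := ℝ) hv0
  have huL : u ∈ Lᗮ := Submodule.smul_mem _ _ hv
  have hmap : (stdGaussian E).map (fun x => ⟪x, u⟫) = gaussianReal 0 1 := by
    rw [← stdGaussian_real]
    refine stdGaussian_map_of_adjoint (by fun_prop) (fun t : ℝ => t • u) ?_ ?_
    · intro x t
      simp [inner_smul_right]
    · intro t
      simp [norm_smul, hu1]
  have : NullSingletonClass (gaussianReal 0 1) := nullSingletonClass_gaussianReal one_ne_zero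
  have h0 : (stdGaussian E).map (fun x => ⟪x, u⟫) {0} = 0 := by rw [hmap]; exact measure_singleton 0
  rw [Measure.map_apply (by fun_prop) (measurableSet_singleton 0)] at h0
  refine measure_mono_null ?_ h0
  intro x hx
  exact Submodule.inner_right_of_mem_orthogonal hx huL

theorem integral_exp_neg_mul_sq_gaussianReal {t : ℝ} (ht : 0 ≤ t) :
    ∫ x, Real.exp (-(t * x ^ 2)) ∂(gaussianReal 0 1) = (1 + 2 * t) ^ (-(1 / 2) : ℝ) := by
  rw [integral_gaussianReal_eq_integral_smul one_ne_zero]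
  have h : ∀ x : ℝ, gaussianPDFReal 0 1 x • Real.exp (-(t * x ^ 2))
      = (√(2 * Real.pi))⁻¹ * Real.exp (-(t + 1 / 2) * x ^ 2) := by
    intro x
    rw [gaussianPDFReal, smul_eq_mul, mul_assoc, ← Real.exp_add]
    simp only [NNReal.coe_one, mul_one, sub_zero]
    congr 2
    ring
  simp_rw [h]
  rw [integral_const_mul, integral_gaussian, Real.rpow_neg (by positivity), ← Real.sqrt_eq_rpow,
    ← Real.sqrt_inv, ← Real.sqrt_inv, ← Real.sqrt_mul (by positivity)]
  congr 1
  have := Real.pi_pos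
  field_simp
  ring

/-- Laplace transform of the chi-square law: in an orthonormal basis the exponential factors over
independent coordinates. -/
theorem lintegral_exp_neg_mul_norm_sq_stdGaussian {t : ℝ} (ht : 0 ≤ t) :
    ∫⁻ x, ENNReal.ofReal (Real.exp (-(t * ‖x‖ ^ 2))) ∂(stdGaussian F)
      = ENNReal.ofReal ((1 + 2 * t) ^ (-((finrank ℝ F : ℝ) / 2))) := by
  have hint : Integrable (fun x : F => Real.exp (-(t * ‖x‖ ^ 2))) (stdGaussian F) := by
    refine Integrable.of_bound (C := 1) (by fun_prop) (ae_of_all _ fun x => ?_)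
    rw [Real.norm_eq_abs, Real.abs_exp, Real.exp_le_one_iff]
    have := mul_nonneg ht (sq_nonneg ‖x‖)
    linarith
  rw [← ofReal_integral_eq_lintegral_ofReal hint (ae_of_all _ fun x => (Real.exp_pos _).le)]
  congr 1
  rw [stdGaussian_eq_map_pi_orthonormalBasis (stdOrthonormalBasis ℝ F),
    integral_map (Measurable.aemeasurable (by fun_prop)) (by fun_prop)]
  have h : ∀ x : Fin (finrank ℝ F) → ℝ,
      Real.exp (-(t * ‖∑ i, x i • stdOrthonormalBasis ℝ F i‖ ^ 2))
        = ∏ i, Real.exp (-(t * x i ^ 2)) := by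
    intro x
    rw [← Real.exp_sum, Finset.sum_neg_distrib, ← Finset.mul_sum]
    congr 3
    rw [← (stdOrthonormalBasis ℝ F).sum_sq_norm_inner_right]
    refine Finset.sum_congr rfl fun i _ => ?_
    rw [Orthonormal.inner_right_fintype (stdOrthonormalBasis ℝ F).orthonormal, Real.norm_eq_abs,
      sq_abs]
  simp_rw [h]
  rw [integral_fintype_prod_eq_prod (f := fun _ x => Real.exp (-(t * x ^ 2)))]
  simp_rw [integral_exp_neg_mul_sq_gaussianReal ht]
  rw [Finset.prod_const, Finset.card_univ, Fintype.card_fin, ← Real.rpow_natCast, ← Real.rpow_mul]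
  · congr 1
    ring
  · positivity

theorem integral_one_add_two_mul_rpow {b : ℝ} (hb : 2 < b) :
    IntegrableOn (fun t : ℝ => (1 + 2 * t) ^ (-(b / 2))) (Ioi 0) ∧
    ∫ t in Ioi (0 : ℝ), (1 + 2 * t) ^ (-(b / 2)) = (b - 2)⁻¹ := by
  have hb' : b - 2 ≠ 0 := by linarith
  have hderiv : ∀ t ∈ Ici (0 : ℝ),
      HasDerivAt (fun t : ℝ => -(b - 2)⁻¹ * (1 + 2 * t) ^ (1 - b / 2)) ((1 + 2 * t) ^ (-(b / 2)))
        t := by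
    intro t ht
    have ht' : (1 + 2 * t) ≠ 0 := by have : (0 : ℝ) ≤ t := ht; positivity
    have h1 : HasDerivAt (fun t : ℝ => 1 + 2 * t) 2 t := by
      simpa using ((hasDerivAt_id t).const_mul 2).const_add 1
    have h2 := (h1.rpow_const (p := 1 - b / 2) (Or.inl ht')).const_mul (-(b - 2)⁻¹)
    refine h2.congr_deriv ?_
    rw [show (1 - b / 2 - 1) = -(b / 2) by ring]
    field_simp
    ring
  have htend : Tendsto (fun t : ℝ => -(b - 2)⁻¹ * (1 + 2 * t) ^ (1 - b / 2)) atTop (𝓝 0) := by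
    have h1 : Tendsto (fun t : ℝ => 1 + 2 * t) atTop atTop :=
      tendsto_atTop_add_const_left _ _ (tendsto_id.const_mul_atTop two_pos)
    have h2 := (tendsto_rpow_neg_atTop (y := b / 2 - 1) (by linarith)).comp h1
    have h3 := h2.const_mul (-(b - 2)⁻¹)
    simpa [Function.comp_def] using h3
  have hnn : ∀ t ∈ Ioi (0 : ℝ), 0 ≤ (1 + 2 * t) ^ (-(b / 2)) := by
    intro t ht
    have : (0 : ℝ) < t := ht
    positivity
  refine ⟨integrableOn_Ioi_deriv_of_nonneg' hderiv hnn htend, ?_⟩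
  rw [integral_Ioi_of_hasDerivAt_of_nonneg' hderiv hnn htend]
  simp

theorem lintegral_one_add_two_mul_rpow {b : ℝ} (hb : 2 < b) :
    ∫⁻ t in Ioi (0 : ℝ), ENNReal.ofReal (t ^ 0 * (1 + 2 * t) ^ (-(b / 2)))
      = ENNReal.ofReal (b - 2)⁻¹ := by
  obtain ⟨hi, hv⟩ := integral_one_add_two_mul_rpow hb
  simp only [pow_zero, one_mul]
  rw [← hv, ofReal_integral_eq_lintegral_ofReal hi]
  filter_upwards [ae_restrict_mem measurableSet_Ioi] with t ht
  have : (0 : ℝ) < t := ht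
  positivity

theorem lintegral_mul_one_add_two_mul_rpow {b : ℝ} (hb : 4 < b) :
    ∫⁻ t in Ioi (0 : ℝ), ENNReal.ofReal (t ^ 1 * (1 + 2 * t) ^ (-(b / 2)))
      = ENNReal.ofReal ((b - 2) * (b - 4))⁻¹ := by
  obtain ⟨hi, hv⟩ := integral_one_add_two_mul_rpow (b := b) (by linarith)
  obtain ⟨hi', hv'⟩ := integral_one_add_two_mul_rpow (b := b - 2) (by linarith)
  -- Writing `t = ((1 + 2t) - 1) / 2` reduces to the previous integral with parameters `b - 2` and
  -- `b`.
  have heq : ∀ t ∈ Ioi (0 : ℝ), t ^ 1 * (1 + 2 * t) ^ (-(b / 2))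
      = 2⁻¹ * ((1 + 2 * t) ^ (-((b - 2) / 2)) - (1 + 2 * t) ^ (-(b / 2))) := by
    intro t ht
    have : (0 : ℝ) < t := ht
    have h1 : (1 + 2 * t) ^ (-((b - 2) / 2)) = (1 + 2 * t) ^ (-(b / 2)) * (1 + 2 * t) := by
      rw [show -((b - 2) / 2) = -(b / 2) + 1 by ring, Real.rpow_add_one (by positivity)]
    rw [h1]
    ring
  rw [setLIntegral_congr_fun measurableSet_Ioi fun t ht => congrArg ENNReal.ofReal (heq t ht),
    ← ofReal_integral_eq_lintegral_ofReal (f := fun t : ℝ => 2⁻¹ * ((1 + 2 * t) ^ (-((b - 2) / 2))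
      - (1 + 2 * t) ^ (-(b / 2)))) ((hi'.sub hi).const_mul _), integral_const_mul,
    integral_sub hi' hi, hv, hv']
  · congr 1
    have h2 : b - 2 ≠ 0 := by linarith
    have h4 : b - 4 ≠ 0 := by linarith
    have h4' : b - 2 - 2 ≠ 0 := by intro h; apply h4; linarith
    field_simp
    ring
  · filter_upwards [ae_restrict_mem measurableSet_Ioi] with t ht
    have h := heq t ht
    have : (0 : ℝ) < t := ht
    simp only [Pi.zero_apply]
    rw [← h]
    positivity

theorem lintegral_pow_mul_exp_neg_mul {q : ℝ} (hq : 0 < q) (j : ℕ) :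
    ∫⁻ t in Ioi (0 : ℝ), ENNReal.ofReal (t ^ j * Real.exp (-(t * q)))
      = ENNReal.ofReal ((j.factorial : ℝ) * (q ^ (j + 1))⁻¹) := by
  have hv := Real.integral_rpow_mul_exp_neg_mul_Ioi (a := j + 1) (r := q) (by positivity) hq
  have heq : ∀ t ∈ Ioi (0 : ℝ), t ^ ((j + 1 : ℝ) - 1) * Real.exp (-(q * t))
      = t ^ j * Real.exp (-(t * q)) := by
    intro t _
    rw [add_sub_cancel_right, Real.rpow_natCast, mul_comm q]
  rw [setIntegral_congr_fun measurableSet_Ioi heq, Real.Gamma_nat_eq_factorial] at hv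
  have hpos : (0 : ℝ) < (1 / q) ^ ((j : ℝ) + 1) * (j.factorial : ℝ) := by positivity
  -- A non-integrable function would have Bochner integral `0`, but the value is positive.
  have hi : IntegrableOn (fun t : ℝ => t ^ j * Real.exp (-(t * q))) (Ioi 0) := by
    by_contra h
    rw [integral_undef h] at hv
    exact hpos.ne hv
  rw [← ofReal_integral_eq_lintegral_ofReal hi, hv]
  · congr 1
    rw [mul_comm, one_div]
    congr 1
    rw [Real.inv_rpow hq.le]
    norm_cast
  · filter_upwards [ae_restrict_mem measurableSet_Ioi] with t ht
    have : (0 : ℝ) < t := ht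
    simp only [Pi.zero_apply]
    positivity

/-- Negative powers of `‖x‖²` are Gamma integrals of `exp (-t ‖x‖²)`; Tonelli then leaves only the
Laplace transform. -/
theorem lintegral_inv_norm_sq_pow_stdGaussian [Nontrivial F] (j : ℕ) :
    ∫⁻ x, ENNReal.ofReal ((j.factorial : ℝ) * ((‖x‖ ^ 2) ^ (j + 1))⁻¹) ∂(stdGaussian F)
      = ∫⁻ t in Ioi (0 : ℝ), ENNReal.ofReal (t ^ j * (1 + 2 * t) ^ (-((finrank ℝ F : ℝ) / 2))) := by
  have hne : ∀ᵐ x ∂(stdGaussian F), x ≠ 0 := by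
    have h := stdGaussian_submodule_eq_zero (E := F) (L := ⊥) bot_ne_top
    rw [ae_iff]
    simpa using h
  calc ∫⁻ x, ENNReal.ofReal ((j.factorial : ℝ) * ((‖x‖ ^ 2) ^ (j + 1))⁻¹) ∂(stdGaussian F)
      = ∫⁻ x, (∫⁻ t in Ioi (0 : ℝ), ENNReal.ofReal (t ^ j * Real.exp (-(t * ‖x‖ ^ 2))))
          ∂(stdGaussian F) := by
        refine lintegral_congr_ae ?_
        filter_upwards [hne] with x hx
        rw [lintegral_pow_mul_exp_neg_mul (by positivity)]
    _ = ∫⁻ t in Ioi (0 : ℝ), (∫⁻ x, ENNReal.ofReal (t ^ j * Real.exp (-(t * ‖x‖ ^ 2)))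
          ∂(stdGaussian F)) := by
        rw [lintegral_lintegral_swap]
        fun_prop
    _ = _ := by
        refine setLIntegral_congr_fun measurableSet_Ioi fun t ht => ?_
        have ht' : (0 : ℝ) < t := ht
        have h0 : 0 ≤ t ^ j := by positivity
        simp_rw [ENNReal.ofReal_mul h0]
        rw [lintegral_const_mul _ (by fun_prop), lintegral_exp_neg_mul_norm_sq_stdGaussian ht'.le]

theorem lintegral_inv_norm_sq_stdGaussian (hF : 2 < finrank ℝ F) :
    ∫⁻ x, ENNReal.ofReal (‖x‖ ^ 2)⁻¹ ∂(stdGaussian F)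
      = ENNReal.ofReal ((finrank ℝ F : ℝ) - 2)⁻¹ := by
  have : Nontrivial F := Module.nontrivial_of_finrank_pos (R := ℝ) (by omega)
  have h := lintegral_inv_norm_sq_pow_stdGaussian (F := F) 0
  rw [lintegral_one_add_two_mul_rpow (by exact_mod_cast hF)] at h
  simpa using h

theorem lintegral_inv_norm_sq_sq_stdGaussian (hF : 4 < finrank ℝ F) :
    ∫⁻ x, ENNReal.ofReal ((‖x‖ ^ 2)⁻¹ ^ 2) ∂(stdGaussian F)
      = ENNReal.ofReal (((finrank ℝ F : ℝ) - 2) * ((finrank ℝ F : ℝ) - 4))⁻¹ := by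
  have : Nontrivial F := Module.nontrivial_of_finrank_pos (R := ℝ) (by omega)
  have h := lintegral_inv_norm_sq_pow_stdGaussian (F := F) 1
  rw [lintegral_mul_one_add_two_mul_rpow (by exact_mod_cast hF)] at h
  simpa [inv_pow] using h

end StdGaussian

/-! ### Measurability of determinants and inverse matrices. -/

section Measurability

variable {α ι : Type*} [MeasurableSpace α] [Fintype ι] [DecidableEq ι]

theorem measurable_det {A : α → Matrix ι ι ℝ} (hA : ∀ i j, Measurable fun x => A x i j) :
    Measurable fun x => (A x).det := by
  simp_rw [Matrix.det_apply]
  exact Finset.measurable_sum _ fun σ _ =>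
    (Finset.measurable_prod _ fun i _ => hA _ _).const_smul _

theorem measurable_inv_apply {A : α → Matrix ι ι ℝ} (hA : ∀ i j, Measurable fun x => A x i j)
    (i j : ι) : Measurable fun x => (A x)⁻¹ i j := by
  simp_rw [Matrix.inv_def, Ring.inverse_eq_inv', Matrix.smul_apply, smul_eq_mul,
    Matrix.adjugate_apply]
  refine (measurable_det hA).inv.mul (measurable_det fun k l => ?_)
  by_cases hk : k = j
  · subst hk
    simp [Matrix.updateRow_self]
  · simpa [Matrix.updateRow_ne hk] using hA k l

end Measurability

/-! ### Inverse Gram matrices of independent Gaussian vectors. -/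

section Gram

variable {E : Type*} [NormedAddCommGroup E] [InnerProductSpace ℝ E]

theorem posSemidef_inv_gram {ι : Type*} [Fintype ι] [DecidableEq ι] (v : ι → E) :
    (Matrix.gram ℝ v)⁻¹.PosSemidef :=
  (Matrix.posSemidef_gram ℝ v).inv

theorem inv_gram_apply_self_nonneg {ι : Type*} [Fintype ι] [DecidableEq ι] (v : ι → E) (i : ι) :
    0 ≤ (Matrix.gram ℝ v)⁻¹ i i :=
  (posSemidef_inv_gram v).diag_nonneg

variable [FiniteDimensional ℝ E]

/-- A diagonal entry of an inverse Gram matrix is the inverse squared distance from the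
corresponding vector to the span of the others. -/
theorem inv_gram_apply_self {ι : Type*} [Fintype ι] [DecidableEq ι] {v : ι → E}
    (hv : LinearIndependent ℝ v) (i : ι) (L : Submodule ℝ E)
    (hL : L = Submodule.span ℝ (v '' {i}ᶜ)) :
    (Matrix.gram ℝ v)⁻¹ i i = (‖Lᗮ.orthogonalProjectionOnto (v i)‖ ^ 2)⁻¹ := by
  set W := Matrix.gram ℝ v with hW
  have hdet : IsUnit W.det :=
    isUnit_iff_ne_zero.2 (Matrix.det_gram_ne_zero_iff_linearIndependent.2 hv)
  have hmem : ∀ j, j ≠ i → v j ∈ L := by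
    intro j hj
    rw [hL]
    exact Submodule.subset_span ⟨j, hj, rfl⟩
  -- The dual basis vector of `v i`: it pairs to `1` with `v i` and to `0` with the other vectors.
  set u : E := ∑ j, W⁻¹ i j • v j with hu
  have hinner : ∀ l, ⟪u, v l⟫ = (1 : Matrix ι ι ℝ) i l := by
    intro l
    rw [← Matrix.nonsing_inv_mul W hdet, hu, sum_inner, Matrix.mul_apply]
    refine Finset.sum_congr rfl fun j _ => ?_
    rw [real_inner_smul_left, hW, Matrix.gram_apply]
  have huL : u ∈ Lᗮ := by
    have hle : L ≤ (Submodule.span ℝ {u})ᗮ := by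
      rw [hL, Submodule.span_le]
      rintro _ ⟨l, hl, rfl⟩
      rw [SetLike.mem_coe, Submodule.mem_orthogonal_singleton_iff_inner_right, hinner,
        Matrix.one_apply_ne (Ne.symm hl)]
    rw [Submodule.mem_orthogonal']
    intro y hy
    exact Submodule.mem_orthogonal_singleton_iff_inner_right.1 (hle hy)
  -- Projecting onto `Lᗮ` fixes `u` and kills every `v j` with `j ≠ i`; pairing the result with `v
  -- i` gives `1 = W⁻¹ i i * ‖P (v i)‖²`, where `P` is that projection.
  have hPu : Lᗮ.starProjection u = W⁻¹ i i • Lᗮ.starProjection (v i) := by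
    rw [hu, map_sum, Finset.sum_eq_single i]
    · rw [map_smul]
    · intro j _ hj
      rw [map_smul, Submodule.starProjection_orthogonal_apply_eq_zero (hmem j hj), smul_zero]
    · simp
  rw [Submodule.starProjection_eq_self_iff.2 huL] at hPu
  refine eq_inv_of_mul_eq_one_left ?_
  have h1 := hinner i
  rw [Matrix.one_apply_eq, hPu, real_inner_smul_left] at h1
  rw [← h1]
  congr 1
  change ‖Lᗮ.starProjection (v i)‖ ^ 2 = _
  rw [← real_inner_self_eq_norm_sq,
    Submodule.inner_starProjection_left_eq_right, Submodule.inner_starProjection_left_eq_right,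
    Submodule.starProjection_eq_self_iff.2 (Submodule.starProjection_apply_mem _ _)]

variable [MeasurableSpace E] [BorelSpace E]

theorem stdGaussian_map_orthogonalProjection (K : Submodule ℝ E) :
    (stdGaussian E).map K.orthogonalProjectionOnto = stdGaussian K :=
  stdGaussian_map_of_adjoint (by fun_prop) (fun t => (t : E))
    (fun x t => by
      rw [Submodule.coe_inner, ← Submodule.starProjection_apply,
        Submodule.inner_starProjection_left_eq_right,
        Submodule.starProjection_eq_self_iff.2 t.2])
    fun _ => rfl

/-- Induction on `s`: the span of the other vectors is a proper subspace, which a fresh Gaussian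
vector almost surely avoids. -/
theorem ae_linearIndependent_pi_stdGaussian {s : ℕ} (hs : s ≤ finrank ℝ E) :
    ∀ᵐ v ∂(Measure.pi fun _ : Fin s => stdGaussian E), LinearIndependent ℝ v := by
  induction s with
  | zero => exact ae_of_all _ fun v => linearIndependent_empty_type
  | succ s ih =>
    have hmp := measurePreserving_piFinSuccAbove (fun _ : Fin (s + 1) => stdGaussian E) 0
    have hmeas : MeasurableSet {v : Fin (s + 1) → E | LinearIndependent ℝ v} :=
      isOpen_setOfPred_linearIndependent.measurableSet
    rw [← hmp.symm.map_eq, ae_map_iff hmp.symm.measurable.aemeasurable hmeas]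
    have hmeas' := hmp.symm.measurable hmeas
    rw [ae_iff]
    change ((stdGaussian E).prod (Measure.pi fun _ : Fin s => stdGaussian E))
      ((MeasurableEquiv.piFinSuccAbove (fun _ : Fin (s + 1) => E) 0).symm ⁻¹'
        {v | LinearIndependent ℝ v})ᶜ = 0
    rw [Measure.prod_apply_symm hmeas'.compl]
    refine (lintegral_congr_ae ?_).trans lintegral_zero
    filter_upwards [ih (by omega)] with w hw
    refine measure_mono_null ?_ (stdGaussian_submodule_eq_zero (E := E)
      (L := Submodule.span ℝ (range w)) ?_)
    · intro x hx
      by_contra hxs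
      refine hx ?_
      change LinearIndependent ℝ (Fin.insertNth 0 x w : Fin (s + 1) → E)
      rw [Fin.insertNth_zero']
      exact linearIndependent_finCons.2 ⟨hw, hxs⟩
    · intro htop
      have h1 := finrank_range_le_card (R := ℝ) w
      rw [Set.finrank, htop, finrank_top, Fintype.card_fin] at h1
      omega

/-- Fix all vectors but the `i`-th. Its projection onto the orthogonal complement of their span is
standard Gaussian in dimension `finrank ℝ E - s`, so the conditional integral is almost surely the
constant `c`. -/
theorem lintegral_inv_gram_apply_self {s : ℕ} (hs : s < finrank ℝ E) (i : Fin (s + 1))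
    {g : ℝ → ℝ≥0∞} (hg : Measurable g) {c : ℝ≥0∞}
    (hc : ∀ K : Submodule ℝ E, finrank ℝ K = finrank ℝ E - s →
      ∫⁻ x, g (‖x‖ ^ 2)⁻¹ ∂(stdGaussian K) = c) :
    ∫⁻ v, g ((Matrix.gram ℝ v)⁻¹ i i) ∂(Measure.pi fun _ : Fin (s + 1) => stdGaussian E) = c := by
  obtain ⟨G, hG⟩ : ∃ G : (Fin (s + 1) → E) → ℝ≥0∞, ∀ v, G v = g ((Matrix.gram ℝ v)⁻¹ i i) :=
    ⟨_, fun _ => rfl⟩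
  simp_rw [← hG]
  have hmp := measurePreserving_piFinSuccAbove (fun _ : Fin (s + 1) => stdGaussian E) i
  have hmeas : Measurable G := by
    rw [funext hG]
    refine hg.comp (measurable_inv_apply (fun k l => ?_) i i)
    simp only [Matrix.gram_apply]
    fun_prop
  rw [← hmp.symm.lintegral_comp hmeas]
  refine (lintegral_prod_symm _ (hmeas.comp hmp.symm.measurable).aemeasurable).trans ?_
  have hconst : ∀ᵐ w ∂(Measure.pi fun j : Fin s => stdGaussian E),
      ∫⁻ x, (G ∘ (MeasurableEquiv.piFinSuccAbove (fun _ : Fin (s + 1) => E) i).symm) (x, w)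
        ∂(stdGaussian E) = c := by
    filter_upwards [ae_linearIndependent_pi_stdGaussian (E := E) hs.le] with w hw
    set L := Submodule.span ℝ (range w) with hL
    have hLdim : finrank ℝ L = s := by
      rw [hL, finrank_span_eq_card hw, Fintype.card_fin]
    have hdim : finrank ℝ Lᗮ = finrank ℝ E - s := by
      have := L.finrank_add_finrank_orthogonal
      omega
    have hLtop : L ≠ ⊤ := by
      intro h
      rw [h, finrank_top] at hLdim
      omega
    have hgK : Measurable fun x : Lᗮ => g (‖x‖ ^ 2)⁻¹ := hg.comp (by fun_prop)
    rw [← hc Lᗮ hdim, ← stdGaussian_map_orthogonalProjection, lintegral_map hgK (by fun_prop)]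
    have hx : ∀ᵐ x ∂(stdGaussian E), x ∉ L := by
      rw [ae_iff]
      simpa using stdGaussian_submodule_eq_zero hLtop
    refine lintegral_congr_ae ?_
    filter_upwards [hx] with x hx
    change G (Fin.insertNth i x w) = _
    rw [hG]
    congr 1
    have hcomp : (Fin.insertNth i x w : Fin (s + 1) → E) '' {i}ᶜ = range w := by
      rw [← Fin.range_succAbove, ← range_comp]
      congr 1
      ext j
      simp
    rw [inv_gram_apply_self (v := (Fin.insertNth i x w : Fin (s + 1) → E)) ?_ i L (by rw [hcomp])]
    · simp
    · have hcons : LinearIndependent ℝ (Fin.cons x w : Fin (s + 1) → E) :=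
        linearIndependent_finCons.2 ⟨hw, hx⟩
      -- Inserting `x` at position `i` is a cyclic reindexing of putting it first.
      have := hcons.comp (i.cycleRange) (i.cycleRange).injective
      convert this using 1
      ext j
      simp only [Function.comp_apply]
      refine Fin.succAboveCases i ?_ (fun j => ?_) j <;> simp
  rw [lintegral_congr_ae hconst]
  simp

theorem integrable_and_integral_of_lintegral_eq {α : Type*} [MeasurableSpace α] {ν : Measure α}
    {f : α → ℝ} (hf : AEStronglyMeasurable f ν) (hf0 : ∀ x, 0 ≤ f x) {c : ℝ} (hc : 0 ≤ c)
    (h : ∫⁻ x, ENNReal.ofReal (f x) ∂ν = ENNReal.ofReal c) :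
    Integrable f ν ∧ ∫ x, f x ∂ν = c := by
  refine ⟨⟨hf, ?_⟩, ?_⟩
  · rw [hasFiniteIntegral_iff_ofReal (ae_of_all _ hf0), h]
    exact ENNReal.ofReal_lt_top
  · rw [integral_eq_lintegral_of_nonneg_ae (ae_of_all _ hf0) hf, h, ENNReal.toReal_ofReal hc]

theorem measurable_inv_gram_apply {ι : Type*} [Fintype ι] [DecidableEq ι] (i j : ι) :
    Measurable fun v : ι → E => (Matrix.gram ℝ v)⁻¹ i j := by
  refine measurable_inv_apply (fun k l => ?_) i j
  simp only [Matrix.gram_apply]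
  fun_prop

theorem integral_inv_gram_apply_self {s : ℕ} (hs : s + 5 ≤ finrank ℝ E) (i : Fin (s + 1)) :
    Integrable (fun v => (Matrix.gram ℝ v)⁻¹ i i)
      (Measure.pi fun _ : Fin (s + 1) => stdGaussian E) ∧
    ∫ v, (Matrix.gram ℝ v)⁻¹ i i ∂(Measure.pi fun _ : Fin (s + 1) => stdGaussian E)
      = ((finrank ℝ E : ℝ) - s - 2)⁻¹ := by
  have hs' : (s : ℝ) + 5 ≤ finrank ℝ E := by exact_mod_cast hs
  refine integrable_and_integral_of_lintegral_eq
    (measurable_inv_gram_apply i i).aestronglyMeasurable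
    (fun v => inv_gram_apply_self_nonneg v i) (inv_nonneg.2 (by linarith)) ?_
  refine lintegral_inv_gram_apply_self (by omega) i ENNReal.measurable_ofReal fun K hK => ?_
  rw [lintegral_inv_norm_sq_stdGaussian (by omega), hK, Nat.cast_sub (by omega)]

theorem integral_inv_gram_apply_self_sq {s : ℕ} (hs : s + 5 ≤ finrank ℝ E) (i : Fin (s + 1)) :
    Integrable (fun v => (Matrix.gram ℝ v)⁻¹ i i ^ 2)
      (Measure.pi fun _ : Fin (s + 1) => stdGaussian E) ∧
    ∫ v, (Matrix.gram ℝ v)⁻¹ i i ^ 2 ∂(Measure.pi fun _ : Fin (s + 1) => stdGaussian E)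
      = (((finrank ℝ E : ℝ) - s - 2) * ((finrank ℝ E : ℝ) - s - 4))⁻¹ := by
  have hs' : (s : ℝ) + 5 ≤ finrank ℝ E := by exact_mod_cast hs
  refine integrable_and_integral_of_lintegral_eq
    ((measurable_inv_gram_apply i i).pow_const 2).aestronglyMeasurable
    (fun v => sq_nonneg _) (inv_nonneg.2 (mul_nonneg (by linarith) (by linarith))) ?_
  refine lintegral_inv_gram_apply_self (g := fun y => ENNReal.ofReal (y ^ 2)) (by omega) i
    (by fun_prop) fun K hK => ?_
  rw [lintegral_inv_norm_sq_sq_stdGaussian (by omega), hK, Nat.cast_sub (by omega)]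

/-- The quadratic form at `e_i ± e_j` gives `2 |A i j| ≤ A i i + A j j`. This transfers square
integrability from the diagonal to the other entries without computing their moments. -/
theorem sq_apply_le_of_posSemidef {ι : Type*} [Fintype ι] [DecidableEq ι] {A : Matrix ι ι ℝ}
    (hA : A.PosSemidef) (i j : ι) : A i j ^ 2 ≤ A i i ^ 2 + A j j ^ 2 := by
  have h1 := hA.diag_nonneg (i := i)
  have h2 := hA.diag_nonneg (i := j)
  have hsymm : A j i = A i j := by simpa using hA.1.apply i j
  have hquad : ∀ c : ℝ, 0 ≤ A i i + 2 * c * A i j + c ^ 2 * A j j := by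
    intro c
    have h := hA.dotProduct_mulVec_nonneg (Pi.single i 1 + Pi.single j c)
    simp [Matrix.mulVec_add, add_dotProduct, dotProduct_add, Matrix.mulVec_single] at h
    rw [hsymm] at h
    linarith
  have ha := hquad 1
  have hb := hquad (-1)
  nlinarith [mul_nonneg ha hb]

theorem integrable_inv_gram_apply_sq {s : ℕ} (hs : s + 5 ≤ finrank ℝ E) (i j : Fin (s + 1)) :
    Integrable (fun v => (Matrix.gram ℝ v)⁻¹ i j ^ 2)
      (Measure.pi fun _ : Fin (s + 1) => stdGaussian E) := by
  refine ((integral_inv_gram_apply_self_sq hs i).1.add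
    (integral_inv_gram_apply_self_sq hs j).1).mono'
    ((measurable_inv_gram_apply i j).pow_const 2).aestronglyMeasurable (ae_of_all _ fun v => ?_)
  rw [Real.norm_of_nonneg (sq_nonneg _)]
  exact sq_apply_le_of_posSemidef (posSemidef_inv_gram v) i j

end Gram

/-! ### Rank factorization of the covariance and its effect on pseudoinverse, loss and trace. -/

section Factorization

variable {p r : ℕ}

/-- Keep the `r` eigenvectors `U` with nonzero eigenvalues `Λ`: `B = U Λ^{1/2}`, `C = U Λ^{-1/2}`,
`diag d = Λ⁻¹`. -/
theorem exists_factorization {V : Matrix (Fin p) (Fin p) ℝ} (hV : IsModelCov r V) :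
    ∃ (B C : Matrix (Fin p) (Fin r) ℝ) (d : Fin r → ℝ), B * Bᵀ = V ∧ Cᵀ * B = 1 ∧
      (B * Cᵀ)ᵀ = B * Cᵀ ∧ Cᵀ * C = Matrix.diagonal d ∧ ∀ i, 0 < d i := by
  obtain ⟨hpsd, hrank⟩ := hV
  have hH := hpsd.1
  obtain ⟨U, hU, hVU⟩ : ∃ U : Matrix (Fin p) (Fin p) ℝ, Uᵀ * U = 1 ∧
      V = U * Matrix.diagonal hH.eigenvalues * Uᵀ := by
    refine ⟨hH.eigenvectorUnitary, ?_, ?_⟩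
    · have := Unitary.coe_star_mul_self hH.eigenvectorUnitary
      simpa [Matrix.star_eq_conjTranspose, Matrix.conjTranspose_eq_transpose_of_trivial] using this
    · have := hH.spectral_theorem
      rw [Unitary.conjStarAlgAut_apply] at this
      simpa [Matrix.star_eq_conjTranspose, Matrix.conjTranspose_eq_transpose_of_trivial,
        Function.comp_def] using this
  set l := hH.eigenvalues with hl
  have hcard : Fintype.card (Fin r) = Fintype.card {i // l i ≠ 0} := by
    rw [Fintype.card_fin, ← hrank, hH.rank_eq_card_non_zero_eigs]
  let e : Fin r ≃ {i // l i ≠ 0} := Fintype.equivOfCardEq hcard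
  have hpos : ∀ k, 0 < l (e k) := fun k =>
    lt_of_le_of_ne (hpsd.eigenvalues_nonneg _) (Ne.symm (e k).2)
  have horth : ∀ i j, ∑ a, U a i * U a j = if i = j then 1 else 0 := by
    intro i j
    have := congrFun (congrFun hU i) j
    simpa [Matrix.mul_apply, Matrix.one_apply] using this
  have hinj : ∀ k m, ((e k : Fin p) = e m) ↔ k = m := fun k m => by
    rw [Subtype.coe_inj, e.injective.eq_iff]
  refine ⟨Matrix.of fun a k => U a (e k) * √(l (e k)), Matrix.of fun a k => U a (e k) * (√(l (e k)))⁻¹,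
    fun k => (l (e k))⁻¹, ?_, ?_, ?_, ?_, fun k => inv_pos.2 (hpos k)⟩
  · ext a b
    rw [hVU, Matrix.mul_apply, Matrix.mul_apply]
    simp only [Matrix.of_apply, Matrix.transpose_apply, Matrix.mul_diagonal]
    have h1 : ∑ i, U a i * l i * U b i = ∑ i : {i // l i ≠ 0}, U a i * l i * U b i := by
      rw [← Finset.sum_subtype (Finset.univ.filter fun i => l i ≠ 0) (by simp)
        (fun i => U a i * l i * U b i), Finset.sum_filter_of_ne]
      intro i _ h hi
      simp [hi] at h
    rw [h1, ← e.sum_comp]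
    refine Finset.sum_congr rfl fun k _ => ?_
    rw [show U a (e k) * √(l (e k)) * (U b (e k) * √(l (e k)))
      = U a (e k) * (√(l (e k)) * √(l (e k))) * U b (e k) by ring, Real.mul_self_sqrt (hpos k).le]
  · ext k m
    simp only [Matrix.mul_apply, Matrix.of_apply, Matrix.transpose_apply]
    have h1 : ∀ a, U a (e k) * (√(l (e k)))⁻¹ * (U a (e m) * √(l (e m)))
        = ((√(l (e k)))⁻¹ * √(l (e m))) * (U a (e k) * U a (e m)) := fun a => by ring
    simp_rw [h1]
    rw [← Finset.mul_sum, horth, Matrix.one_apply]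
    simp only [hinj]
    split_ifs with h
    · subst h
      have := Real.sqrt_pos.2 (hpos k)
      field_simp
    · simp
  · ext a b
    simp only [Matrix.mul_apply, Matrix.of_apply, Matrix.transpose_apply]
    refine Finset.sum_congr rfl fun k _ => ?_
    ring
  · ext k m
    simp only [Matrix.mul_apply, Matrix.of_apply, Matrix.transpose_apply]
    have h1 : ∀ a, U a (e k) * (√(l (e k)))⁻¹ * (U a (e m) * (√(l (e m)))⁻¹)
        = ((√(l (e k)))⁻¹ * (√(l (e m)))⁻¹) * (U a (e k) * U a (e m)) := fun a => by ring
    simp_rw [h1]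
    rw [← Finset.mul_sum, horth, Matrix.diagonal_apply]
    simp only [hinj]
    split_ifs with h
    · subst h
      rw [mul_one, ← mul_inv, Real.mul_self_sqrt (hpos k).le]
    · simp

variable {B C : Matrix (Fin p) (Fin r) ℝ} {d : Fin r → ℝ}

/-- Both products of the two matrices collapse to the symmetric idempotent `B Cᵀ`, which yields the
four Penrose conditions. -/
theorem pinv_conj (hCB : Cᵀ * B = 1) (hsymm : (B * Cᵀ)ᵀ = B * Cᵀ)
    {W : Matrix (Fin r) (Fin r) ℝ} (hW : IsUnit W.det) :
    pinv (B * W * Bᵀ) = C * W⁻¹ * Cᵀ := by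
  have hBC : Bᵀ * C = 1 := by
    rw [← Matrix.transpose_transpose (Bᵀ * C), Matrix.transpose_mul, Matrix.transpose_transpose,
      hCB, Matrix.transpose_one]
  have hswap : C * Bᵀ = B * Cᵀ := by
    rw [← hsymm, Matrix.transpose_mul, Matrix.transpose_transpose]
  have h1 : B * W * Bᵀ * (C * W⁻¹ * Cᵀ) = B * Cᵀ := by
    calc B * W * Bᵀ * (C * W⁻¹ * Cᵀ) = B * W * (Bᵀ * C) * W⁻¹ * Cᵀ := by
          simp only [Matrix.mul_assoc]
      _ = B * (W * W⁻¹) * Cᵀ := by rw [hBC, Matrix.mul_one]; simp only [Matrix.mul_assoc]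
      _ = B * Cᵀ := by rw [Matrix.mul_nonsing_inv W hW, Matrix.mul_one]
  have h2 : C * W⁻¹ * Cᵀ * (B * W * Bᵀ) = B * Cᵀ := by
    calc C * W⁻¹ * Cᵀ * (B * W * Bᵀ) = C * W⁻¹ * (Cᵀ * B) * W * Bᵀ := by
          simp only [Matrix.mul_assoc]
      _ = C * (W⁻¹ * W) * Bᵀ := by rw [hCB, Matrix.mul_one]; simp only [Matrix.mul_assoc]
      _ = B * Cᵀ := by rw [Matrix.nonsing_inv_mul W hW, Matrix.mul_one, hswap]
  refine (pinv_spec _).unique ⟨?_, ?_, ?_, ?_⟩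
  · calc B * W * Bᵀ * (C * W⁻¹ * Cᵀ) * (B * W * Bᵀ) = B * (Cᵀ * B) * (W * Bᵀ) := by
          rw [h1]; simp only [Matrix.mul_assoc]
      _ = B * W * Bᵀ := by rw [hCB, Matrix.mul_one, Matrix.mul_assoc]
  · calc C * W⁻¹ * Cᵀ * (B * W * Bᵀ) * (C * W⁻¹ * Cᵀ) = C * (Bᵀ * C) * (W⁻¹ * Cᵀ) := by
          rw [h2, ← hswap]; simp only [Matrix.mul_assoc]
      _ = C * W⁻¹ * Cᵀ := by rw [hBC, Matrix.mul_one, Matrix.mul_assoc]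
  · rw [h1, hsymm]
  · rw [h2, hsymm]

theorem trace_mul_diagonal_mul_diagonal {ι : Type*} [Fintype ι] [DecidableEq ι]
    (M N : Matrix ι ι ℝ) (d : ι → ℝ) :
    (M * Matrix.diagonal d * N * Matrix.diagonal d).trace
      = ∑ i, ∑ j, d i * d j * (M i j * N j i) := by
  refine Finset.sum_congr rfl fun i _ => ?_
  rw [Matrix.diag_apply, Matrix.mul_diagonal, Matrix.mul_apply, Finset.sum_mul]
  refine Finset.sum_congr rfl fun j _ => ?_
  rw [Matrix.mul_diagonal]
  ring

/-- Cyclicity of the trace brings together the factors `Cᵀ C = diag d`, which become entrywise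
weights. -/
theorem frobeniusLoss_conj (hC : Cᵀ * C = Matrix.diagonal d) (M N : Matrix (Fin r) (Fin r) ℝ) :
    frobeniusLoss (C * M * Cᵀ) (C * N * Cᵀ) = ∑ i, ∑ j, d i * d j * (M i j - N i j) ^ 2 := by
  set D := M - N with hD
  have h0 : C * M * Cᵀ - C * N * Cᵀ = C * D * Cᵀ := by
    rw [hD, Matrix.mul_sub, Matrix.sub_mul]
  have h1 : frobeniusLoss (C * M * Cᵀ) (C * N * Cᵀ) = ((C * D * Cᵀ) * (C * D * Cᵀ)ᵀ).trace := by
    rw [frobeniusLoss_eq_sum, ← h0]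
    refine Finset.sum_congr rfl fun i _ => ?_
    rw [Matrix.diag_apply, Matrix.mul_apply]
    refine Finset.sum_congr rfl fun j _ => ?_
    rw [Matrix.transpose_apply, Matrix.sub_apply, sq]
  have h2 : ((C * D * Cᵀ) * (C * D * Cᵀ)ᵀ) = C * (D * Matrix.diagonal d * Dᵀ * Cᵀ) := by
    rw [← hC]
    simp only [Matrix.transpose_mul, Matrix.transpose_transpose, Matrix.mul_assoc]
  rw [h1, h2, Matrix.trace_mul_comm, Matrix.mul_assoc _ Cᵀ, hC, trace_mul_diagonal_mul_diagonal]
  simp [hD, sq]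

theorem trace_conj_sq (hC : Cᵀ * C = Matrix.diagonal d) {M : Matrix (Fin r) (Fin r) ℝ}
    (hM : Mᵀ = M) :
    ((C * M * Cᵀ) ^ 2).trace = ∑ i, ∑ j, d i * d j * M i j ^ 2 := by
  have h2 : (C * M * Cᵀ) ^ 2 = C * (M * Matrix.diagonal d * M * Cᵀ) := by
    rw [← hC, sq]
    simp only [Matrix.mul_assoc]
  rw [h2, Matrix.trace_mul_comm, Matrix.mul_assoc _ Cᵀ, hC, trace_mul_diagonal_mul_diagonal]
  refine Finset.sum_congr rfl fun i _ => Finset.sum_congr rfl fun j _ => ?_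
  have : M j i = M i j := congrFun (congrFun hM i) j
  rw [this, sq]

end Factorization

/-! ### The sample as an affine image of standard Gaussians; centering as an orthogonal projection.
-/

section Law

variable {E : Type*} [NormedAddCommGroup E] [InnerProductSpace ℝ E] [FiniteDimensional ℝ E]
  [MeasurableSpace E] [BorelSpace E]

theorem map_toLp_pi_stdGaussian {ι : Type*} [Fintype ι] :
    (Measure.pi fun _ : ι => stdGaussian E).map (WithLp.toLp 2)
      = stdGaussian (PiLp 2 fun _ : ι => E) := by
  have : IsProbabilityMeasure ((Measure.pi fun _ : ι => stdGaussian E).map (WithLp.toLp 2)) :=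
    Measure.isProbabilityMeasure_map (by fun_prop)
  apply Measure.ext_of_charFun
  ext t
  rw [charFun_stdGaussian, charFun_pi]
  simp_rw [charFun_stdGaussian]
  rw [← Complex.exp_sum, ← Complex.ofReal_pow, PiLp.norm_sq_eq_of_L2]
  congr 1
  push_cast
  rw [← Finset.sum_neg_distrib, Finset.sum_div]

/-- The columns of a matrix with i.i.d. standard Gaussian rows, projected onto a subspace, are
i.i.d. standard Gaussian in that subspace. -/
theorem pi_stdGaussian_map_columns {n r : ℕ} (K : Submodule ℝ (EuclideanSpace ℝ (Fin n))) :
    (Measure.pi fun _ : Fin n => stdGaussian (EuclideanSpace ℝ (Fin r))).map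
      (fun z (i : Fin r) => K.orthogonalProjectionOnto (WithLp.toLp 2 fun k => z k i))
      = Measure.pi fun _ : Fin r => stdGaussian K := by
  apply (MeasurableEquiv.toLp 2 (Fin r → K)).map_measurableEquiv_injective
  rw [MeasurableEquiv.coe_toLp, map_toLp_pi_stdGaussian, Measure.map_map (by fun_prop) (by fun_prop)]
  set L : (PiLp 2 fun _ : Fin n => EuclideanSpace ℝ (Fin r)) → PiLp 2 fun _ : Fin r => K :=
    fun z => WithLp.toLp 2 fun i => K.orthogonalProjectionOnto (WithLp.toLp 2 fun k => z k i) with hL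
  have hLm : Measurable L := by fun_prop
  -- The adjoint includes `K` in the ambient space and transposes the array; both preserve the sum
  -- of squares.
  rw [← stdGaussian_map_of_adjoint hLm
    (fun t => WithLp.toLp 2 fun k => WithLp.toLp 2 fun i => (t i : EuclideanSpace ℝ (Fin n)) k) ?_ ?_,
    ← map_toLp_pi_stdGaussian (E := EuclideanSpace ℝ (Fin r)), Measure.map_map hLm (by fun_prop)]
  · rfl
  · intro z t
    simp only [hL, PiLp.inner_apply]
    have h1 : ∀ (v : EuclideanSpace ℝ (Fin n)) (w : K),
        ⟪K.orthogonalProjectionOnto v, w⟫ = ⟪v, (w : EuclideanSpace ℝ (Fin n))⟫ := fun v w => by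
      rw [Submodule.coe_inner]
      change ⟪K.starProjection v, _⟫ = _
      rw [Submodule.inner_starProjection_left_eq_right, Submodule.starProjection_eq_self_iff.2 w.2]
    simp_rw [h1, PiLp.inner_apply]
    rw [Finset.sum_comm]
  · intro t
    rw [← sq_eq_sq₀ (norm_nonneg _) (norm_nonneg _), PiLp.norm_sq_eq_of_L2, PiLp.norm_sq_eq_of_L2]
    simp_rw [EuclideanSpace.norm_sq_eq]
    rw [Finset.sum_comm]
    refine Finset.sum_congr rfl fun i _ => ?_
    rw [Submodule.coe_norm, EuclideanSpace.norm_sq_eq]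

variable {n p r : ℕ} {μ : EuclideanSpace ℝ (Fin p)} {V : Matrix (Fin p) (Fin p) ℝ}
  {B C : Matrix (Fin p) (Fin r) ℝ}

/-- Characteristic functions agree, since `‖Bᵀ t‖² = ⟪t, V t⟫`. -/
theorem multivariateGaussian_eq_map (hBV : B * Bᵀ = V) :
    multivariateGaussian μ V
      = (stdGaussian (EuclideanSpace ℝ (Fin r))).map
        fun z => μ + WithLp.toLp 2 (B *ᵥ WithLp.ofLp z) := by
  have hV : V.PosSemidef := by
    have := Matrix.posSemidef_self_mul_conjTranspose B
    rwa [Matrix.conjTranspose_eq_transpose_of_trivial, hBV] at this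
  have hmeas : Measurable fun z : EuclideanSpace ℝ (Fin r) =>
      (WithLp.toLp 2 (B *ᵥ WithLp.ofLp z) : EuclideanSpace ℝ (Fin p)) := by
    have : Continuous fun z : EuclideanSpace ℝ (Fin r) => B *ᵥ WithLp.ofLp z := by fun_prop
    exact ((PiLp.continuous_toLp 2 _).comp this).measurable
  have hprob : IsProbabilityMeasure ((stdGaussian (EuclideanSpace ℝ (Fin r))).map
        fun z => μ + (WithLp.toLp 2 (B *ᵥ WithLp.ofLp z) : EuclideanSpace ℝ (Fin p))) :=
    Measure.isProbabilityMeasure_map (hmeas.const_add μ).aemeasurable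
  have hadj : ∀ (z : EuclideanSpace ℝ (Fin r)) (t : EuclideanSpace ℝ (Fin p)),
      ⟪(WithLp.toLp 2 (B *ᵥ WithLp.ofLp z) : EuclideanSpace ℝ (Fin p)), t⟫
        = ⟪z, (WithLp.toLp 2 (Bᵀ *ᵥ WithLp.ofLp t) : EuclideanSpace ℝ (Fin r))⟫ := by
    intro z t
    simp only [EuclideanSpace.inner_eq_star_dotProduct, star_trivial]
    rw [Matrix.mulVec_transpose, Matrix.dotProduct_mulVec]
  apply Measure.ext_of_charFun
  ext t
  rw [charFun_multivariateGaussian hV]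
  have h1 : (stdGaussian (EuclideanSpace ℝ (Fin r))).map
        (fun z => μ + (WithLp.toLp 2 (B *ᵥ WithLp.ofLp z) : EuclideanSpace ℝ (Fin p)))
      = ((stdGaussian (EuclideanSpace ℝ (Fin r))).map
        (fun z => (WithLp.toLp 2 (B *ᵥ WithLp.ofLp z) : EuclideanSpace ℝ (Fin p)))).map (μ + ·) := by
    rw [Measure.map_map (by fun_prop) hmeas]
    rfl
  rw [h1, charFun_map_const_add, charFun_apply, integral_map hmeas.aemeasurable (by fun_prop)]
  simp_rw [hadj]
  rw [← charFun_apply, charFun_stdGaussian, ← Complex.exp_add, real_inner_comm]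
  congr 1
  rw [← Complex.ofReal_pow, ← real_inner_self_eq_norm_sq, ← hadj]
  simp only [EuclideanSpace.inner_eq_star_dotProduct, star_trivial]
  rw [Matrix.mulVec_mulVec, hBV]
  ring

theorem sampleLaw_eq_map (hBV : B * Bᵀ = V) :
    sampleLaw n μ V = (Measure.pi fun _ : Fin n => stdGaussian (EuclideanSpace ℝ (Fin r))).map
      fun z k => μ + WithLp.toLp 2 (B *ᵥ WithLp.ofLp (z k)) := by
  have hmeas : Measurable fun z : EuclideanSpace ℝ (Fin r) =>
      μ + (WithLp.toLp 2 (B *ᵥ WithLp.ofLp z) : EuclideanSpace ℝ (Fin p)) := by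
    have : Continuous fun z : EuclideanSpace ℝ (Fin r) => B *ᵥ WithLp.ofLp z := by fun_prop
    exact ((PiLp.continuous_toLp 2 _).comp this).measurable.const_add μ
  rw [sampleLaw, multivariateGaussian_eq_map hBV]
  have : IsProbabilityMeasure ((stdGaussian (EuclideanSpace ℝ (Fin r))).map
      fun z => μ + (WithLp.toLp 2 (B *ᵥ WithLp.ofLp z) : EuclideanSpace ℝ (Fin p))) :=
    Measure.isProbabilityMeasure_map hmeas.aemeasurable
  exact (Measure.pi_map_pi (fun _ => hmeas.aemeasurable)).symm

/-- The subspace of centered vectors. -/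
noncomputable def centeredSubspace (n : ℕ) : Submodule ℝ (EuclideanSpace ℝ (Fin n)) :=
  (Submodule.span ℝ {(WithLp.toLp 2 1 : EuclideanSpace ℝ (Fin n))})ᗮ

theorem finrank_centeredSubspace (hn : n ≠ 0) : finrank ℝ (centeredSubspace n) = n - 1 := by
  have h0 : (WithLp.toLp 2 1 : EuclideanSpace ℝ (Fin n)) ≠ 0 := by
    intro h
    have := congrArg (fun v : EuclideanSpace ℝ (Fin n) => v ⟨0, Nat.pos_of_ne_zero hn⟩) h
    simp at this
  have h1 := (Submodule.span ℝ {(WithLp.toLp 2 1 : EuclideanSpace ℝ (Fin n))}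
    ).finrank_add_finrank_orthogonal
  rw [finrank_span_singleton h0, finrank_euclideanSpace_fin] at h1
  change finrank ℝ (Submodule.span ℝ {(WithLp.toLp 2 1 : EuclideanSpace ℝ (Fin n))})ᗮ = _
  omega

theorem centeredSubspace_orthogonalProjectionOnto_apply (v : EuclideanSpace ℝ (Fin n)) (k : Fin n) :
    ((centeredSubspace n).orthogonalProjectionOnto v : EuclideanSpace ℝ (Fin n)) k
      = v k - (n : ℝ)⁻¹ * ∑ l, v l := by
  change (centeredSubspace n).starProjection v k = _
  rw [centeredSubspace, Submodule.starProjection_orthogonal_val, Submodule.starProjection_singleton,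
    PiLp.sub_apply, PiLp.smul_apply, EuclideanSpace.norm_sq_eq, PiLp.inner_apply]
  simp [div_eq_inv_mul]

/-- The centered data matrix, expressed through the standardized observations. -/
theorem centered_affine (hn : n ≠ 0) (z : Fin n → EuclideanSpace ℝ (Fin r)) :
    centered (fun k => μ + (WithLp.toLp 2 (B *ᵥ WithLp.ofLp (z k)) : EuclideanSpace ℝ (Fin p)))
      = (Matrix.of fun k i => ((centeredSubspace n).orthogonalProjectionOnto
          (WithLp.toLp 2 fun k => z k i) : EuclideanSpace ℝ (Fin n)) k) * Bᵀ := by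
  have hn' : (n : ℝ) ≠ 0 := Nat.cast_ne_zero.2 hn
  ext k a
  simp only [centered, sampleMean, Matrix.of_apply, Matrix.mul_apply, Matrix.transpose_apply,
    centeredSubspace_orthogonalProjectionOnto_apply, PiLp.smul_apply, PiLp.add_apply,
    WithLp.ofLp_sum, Finset.sum_apply, Matrix.mulVec, dotProduct, smul_eq_mul,
    Finset.sum_add_distrib, Finset.sum_const, Finset.card_univ, Fintype.card_fin, nsmul_eq_mul,
    mul_add, inv_mul_cancel_left₀ hn', add_sub_add_left_eq_sub]
  rw [Finset.sum_comm, Finset.mul_sum, ← Finset.sum_sub_distrib]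
  refine Finset.sum_congr rfl fun i _ => ?_
  rw [← Finset.mul_sum]
  ring

end Law

/-! ### Law of the scatter matrix and the risk as a quadratic in `a`. -/

section Risk

variable {n p r : ℕ} {μ : EuclideanSpace ℝ (Fin p)} {V : Matrix (Fin p) (Fin p) ℝ}
  {B C : Matrix (Fin p) (Fin r) ℝ} {d : Fin r → ℝ}

theorem measurable_centered_apply (k : Fin n) (i : Fin p) :
    Measurable fun x : Sample n p => centered x k i := by
  have h : ∀ x : Sample n p, centered x k i = x k i - (n : ℝ)⁻¹ * ∑ l, x l i := fun x => by
    simp [centered, sampleMean]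
  simp_rw [h]
  fun_prop

/-- The scatter matrix of the observations transformed by `Cᵀ`. -/
noncomputable def scatter (C : Matrix (Fin p) (Fin r) ℝ) (x : Sample n p) :
    Matrix (Fin r) (Fin r) ℝ :=
  (centered x * C)ᵀ * (centered x * C)

theorem measurable_centered_mul_apply (C : Matrix (Fin p) (Fin r) ℝ) (k : Fin n) (i : Fin r) :
    Measurable fun x : Sample n p => (centered x * C) k i := by
  simp_rw [Matrix.mul_apply]
  exact Finset.measurable_sum _ fun j _ => (measurable_centered_apply k j).mul_const _

theorem measurable_scatter_apply (C : Matrix (Fin p) (Fin r) ℝ) (i j : Fin r) :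
    Measurable fun x : Sample n p => scatter C x i j := by
  have h : ∀ x : Sample n p, scatter C x i j
      = ∑ k, (centered x * C) k i * (centered x * C) k j := fun x => by
    rw [scatter, Matrix.mul_apply]
    rfl
  simp_rw [h]
  exact Finset.measurable_sum _ fun k _ =>
    (measurable_centered_mul_apply C k i).mul (measurable_centered_mul_apply C k j)

theorem posSemidef_inv_scatter (C : Matrix (Fin p) (Fin r) ℝ) (x : Sample n p) :
    (scatter C x)⁻¹.PosSemidef := by
  have := Matrix.posSemidef_conjTranspose_mul_self (centered x * C)
  rw [Matrix.conjTranspose_eq_transpose_of_trivial] at this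
  exact this.inv

/-- The vectors of standardized centered observations, one for each coordinate. -/
noncomputable def columns (z : Fin n → EuclideanSpace ℝ (Fin r)) (i : Fin r) :
    centeredSubspace n :=
  (centeredSubspace n).orthogonalProjectionOnto (WithLp.toLp 2 fun k => z k i)

theorem measurable_columns :
    Measurable (columns : (Fin n → EuclideanSpace ℝ (Fin r)) → Fin r → centeredSubspace n) := by
  unfold columns
  fun_prop

theorem measurable_affine (μ : EuclideanSpace ℝ (Fin p)) (B : Matrix (Fin p) (Fin r) ℝ) :
    Measurable fun (z : Fin n → EuclideanSpace ℝ (Fin r)) (k : Fin n) =>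
      μ + (WithLp.toLp 2 (B *ᵥ WithLp.ofLp (z k)) : EuclideanSpace ℝ (Fin p)) := by
  refine measurable_pi_lambda _ fun k => ?_
  have : Continuous fun z : Fin n → EuclideanSpace ℝ (Fin r) => B *ᵥ WithLp.ofLp (z k) := by
    fun_prop
  exact ((PiLp.continuous_toLp 2 _).comp this).measurable.const_add μ

theorem transpose_mul_eq_one (hCB : Cᵀ * B = 1) : Bᵀ * C = 1 := by
  rw [← Matrix.transpose_transpose (Bᵀ * C), Matrix.transpose_mul, Matrix.transpose_transpose,
    hCB, Matrix.transpose_one]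

theorem scatter_affine (hn : n ≠ 0) (hCB : Cᵀ * B = 1) (z : Fin n → EuclideanSpace ℝ (Fin r)) :
    scatter C (fun k => μ + (WithLp.toLp 2 (B *ᵥ WithLp.ofLp (z k)) : EuclideanSpace ℝ (Fin p)))
      = Matrix.gram ℝ (columns z) := by
  rw [scatter, centered_affine hn, Matrix.mul_assoc, transpose_mul_eq_one hCB, Matrix.mul_one]
  ext i j
  rw [Matrix.mul_apply, Matrix.gram_apply, Submodule.coe_inner, PiLp.inner_apply]
  refine Finset.sum_congr rfl fun k _ => ?_
  simp [columns, mul_comm]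

/-- Multiplying by `C` undoes `Bᵀ` and centering removes `μ`, so the law no longer depends on the
parameters. -/
theorem identDistrib_inv_scatter (hn : n ≠ 0) (hBV : B * Bᵀ = V) (hCB : Cᵀ * B = 1)
    (i j : Fin r) :
    IdentDistrib (fun x : Sample n p => (scatter C x)⁻¹ i j)
      (fun v : Fin r → centeredSubspace n => (Matrix.gram ℝ v)⁻¹ i j)
      (sampleLaw n μ V) (Measure.pi fun _ => stdGaussian (centeredSubspace n)) where
  aemeasurable_fst := (measurable_inv_apply (measurable_scatter_apply C) i j).aemeasurable
  aemeasurable_snd := (measurable_inv_gram_apply i j).aemeasurable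
  map_eq := by
    rw [sampleLaw_eq_map hBV, ← pi_stdGaussian_map_columns (r := r),
      Measure.map_map (measurable_inv_apply (measurable_scatter_apply C) i j)
        (measurable_affine μ B)]
    refine Eq.trans ?_ (Measure.map_map (measurable_inv_gram_apply i j) measurable_columns).symm
    congr 1
    ext z
    simp only [Function.comp_apply]
    rw [scatter_affine hn hCB]

/-- The centered data have the form `Y Bᵀ`, and `Bᵀ C = 1`. This recovers the whole of `S` from the
`r × r` scatter matrix. -/
theorem ae_sampleLaw_centered (hn : n ≠ 0) (hBV : B * Bᵀ = V) (hCB : Cᵀ * B = 1) :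
    ∀ᵐ x ∂(sampleLaw n μ V), centered x = centered x * C * Bᵀ := by
  have h : ∀ᵐ x ∂(sampleLaw n μ V), ∀ k i, centered x k i = (centered x * (C * Bᵀ)) k i := by
    rw [ae_all_iff]
    intro k
    rw [ae_all_iff]
    intro i
    rw [sampleLaw_eq_map hBV, ae_map_iff (measurable_affine μ B).aemeasurable
      (measurableSet_eq_fun (measurable_centered_apply k i)
        (measurable_centered_mul_apply (C * Bᵀ) k i))]
    refine ae_of_all _ fun z => ?_
    rw [centered_affine hn, Matrix.mul_assoc, ← Matrix.mul_assoc Bᵀ, transpose_mul_eq_one hCB,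
      Matrix.one_mul]
  filter_upwards [h] with x hx
  rw [Matrix.mul_assoc]
  ext k i
  exact hx k i

theorem ae_sampleLaw_det_scatter (hrn : r + 1 ≤ n) (hBV : B * Bᵀ = V) (hCB : Cᵀ * B = 1) :
    ∀ᵐ x ∂(sampleLaw n μ V), (scatter C x).det ≠ 0 := by
  have hn : n ≠ 0 := by omega
  have hmeas : MeasurableSet {x : Sample n p | (scatter C x).det ≠ 0} :=
    (measurable_det (measurable_scatter_apply C)) (measurableSet_singleton 0).compl
  rw [sampleLaw_eq_map hBV, ae_map_iff (measurable_affine μ B).aemeasurable hmeas]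
  have h := ae_linearIndependent_pi_stdGaussian (E := centeredSubspace n) (s := r)
    (by rw [finrank_centeredSubspace hn]; omega)
  rw [← pi_stdGaussian_map_columns (r := r)] at h
  filter_upwards [ae_of_ae_map measurable_columns.aemeasurable h] with z hz
  rw [scatter_affine hn hCB]
  exact Matrix.det_gram_ne_zero_iff_linearIndependent.2 hz

theorem ae_sampleLaw_pinv (hrn : r + 1 ≤ n) (hBV : B * Bᵀ = V) (hCB : Cᵀ * B = 1)
    (hsymm : (B * Cᵀ)ᵀ = B * Cᵀ) :
    ∀ᵐ x ∂(sampleLaw n μ V),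
      pinv (sampleCov x) = C * ((n : ℝ) • (scatter C x)⁻¹) * Cᵀ := by
  have hn : (n : ℝ) ≠ 0 := Nat.cast_ne_zero.2 (by omega)
  filter_upwards [ae_sampleLaw_centered (by omega) hBV hCB,
    ae_sampleLaw_det_scatter hrn hBV hCB] with x hx hdet
  have hS : sampleCov x = B * ((n : ℝ)⁻¹ • scatter C x) * Bᵀ := by
    rw [sampleCov, Matrix.mul_smul, Matrix.smul_mul]
    congr 1
    calc (centered x)ᵀ * centered x = (centered x * C * Bᵀ)ᵀ * (centered x * C * Bᵀ) := by rw [← hx]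
      _ = B * scatter C x * Bᵀ := by
        rw [scatter, Matrix.transpose_mul _ Bᵀ, Matrix.transpose_transpose]
        simp only [Matrix.mul_assoc]
  have hunit : IsUnit ((n : ℝ)⁻¹ • scatter C x).det := by
    rw [Matrix.det_smul]
    exact isUnit_iff_ne_zero.2 (mul_ne_zero (pow_ne_zero _ (inv_ne_zero hn)) hdet)
  rw [hS, pinv_conj hCB hsymm hunit]
  congr 2
  refine Matrix.inv_eq_left_inv ?_
  rw [Matrix.smul_mul, Matrix.mul_smul, smul_smul, mul_inv_cancel₀ hn, one_smul,
    Matrix.nonsing_inv_mul _ (isUnit_iff_ne_zero.2 hdet)]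

/-- The risk of `a S⁺` is a quadratic polynomial in `a`, whose leading coefficient
`T = E tr (S⁺)²` is bounded below in terms of `τ = tr (V⁺)²`. -/
theorem exists_risk_eq (hr : 1 ≤ r) (hrn : r + 5 ≤ n) (μ : EuclideanSpace ℝ (Fin p))
    (hV : IsModelCov r V) :
    ∃ T τ : ℝ, 0 < τ ∧
      τ ≤ ((n : ℝ) - r - 2) / n * (((n : ℝ) - r - 4) / n) * T ∧
      Integrable (fun x => (pinv (sampleCov x) ^ 2).trace) (sampleLaw n μ V) ∧
      ∫ x, (pinv (sampleCov x) ^ 2).trace ∂(sampleLaw n μ V) = T ∧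
      ∀ a : ℝ, risk (n := n) (scaledPinv a) μ V ≠ ⊤ ∧
        (risk (n := n) (scaledPinv a) μ V).toReal
          = a ^ 2 * T - 2 * a * (τ / (((n : ℝ) - r - 2) / n)) + τ := by
  obtain ⟨B, C, d, hBV, hCB, hsymm, hCC, hd⟩ := exists_factorization hV
  obtain ⟨s, rfl⟩ : ∃ s, r = s + 1 := ⟨r - 1, by omega⟩
  have hn0 : n ≠ 0 := by omega
  have hn : (n : ℝ) ≠ 0 := Nat.cast_ne_zero.2 hn0
  have hrn' : (s : ℝ) + 6 ≤ n := by exact_mod_cast (by omega : s + 6 ≤ n)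
  have hprob : IsProbabilityMeasure (sampleLaw n μ V) := by
    unfold sampleLaw; infer_instance
  have hdim : finrank ℝ (centeredSubspace n) = n - 1 := finrank_centeredSubspace hn0
  have hdim' : (finrank ℝ (centeredSubspace n) : ℝ) = n - 1 := by
    rw [hdim, Nat.cast_sub (by omega), Nat.cast_one]
  have hs : s + 5 ≤ finrank ℝ (centeredSubspace n) := by omega
  set P := sampleLaw n μ V with hP
  set H : Sample n p → Matrix (Fin (s + 1)) (Fin (s + 1)) ℝ := fun x => (scatter C x)⁻¹ with hH
  have hid : ∀ i j, IdentDistrib (fun x => H x i j)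
      (fun v : Fin (s + 1) → centeredSubspace n => (Matrix.gram ℝ v)⁻¹ i j) P _ :=
    fun i j => identDistrib_inv_scatter hn0 hBV hCB i j
  have hid2 : ∀ i j, IdentDistrib (fun x => H x i j ^ 2)
      (fun v : Fin (s + 1) → centeredSubspace n => (Matrix.gram ℝ v)⁻¹ i j ^ 2) P _ :=
    fun i j => (hid i j).comp (u := fun y : ℝ => y ^ 2) (by fun_prop)
  have hint1 : ∀ i, Integrable (fun x => H x i i) P := fun i =>
    (hid i i).integrable_iff.2 (integral_inv_gram_apply_self hs i).1
  have hint2 : ∀ i j, Integrable (fun x => H x i j ^ 2) P := fun i j =>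
    (hid2 i j).integrable_iff.2 (integrable_inv_gram_apply_sq hs i j)
  -- The degrees of freedom are `(n - 1) - s = n - r`, so `n - s - 3 = n - r - 2`.
  have hval1 : ∀ i, ∫ x, H x i i ∂P = ((n : ℝ) - s - 3)⁻¹ := fun i => by
    rw [(hid i i).integral_eq, (integral_inv_gram_apply_self hs i).2, hdim']
    congr 1
    ring
  have hval2 : ∀ i, ∫ x, H x i i ^ 2 ∂P = (((n : ℝ) - s - 3) * ((n : ℝ) - s - 5))⁻¹ := fun i => by
    rw [(hid2 i i).integral_eq, (integral_inv_gram_apply_self_sq hs i).2, hdim']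
    congr 2 <;> ring
  have hpinvV : pinv V = C * (1 : Matrix (Fin (s + 1)) (Fin (s + 1)) ℝ) * Cᵀ := by
    have := pinv_conj (W := 1) hCB hsymm (by simp)
    rwa [Matrix.mul_one, hBV, inv_one] at this
  set Q : Sample n p → ℝ := fun x => ∑ i, ∑ j, d i * d j * H x i j ^ 2 with hQ
  have hQint : Integrable Q P :=
    integrable_finsetSum _ fun i _ => integrable_finsetSum _ fun j _ => (hint2 i j).const_mul _
  set R : Sample n p → ℝ := fun x => ∑ i, d i ^ 2 * H x i i with hR
  have hRint : Integrable R P := integrable_finsetSum _ fun i _ => (hint1 i).const_mul _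
  set τ := ∑ i, d i ^ 2 with hτ
  have hRval : ∫ x, R x ∂P = τ * ((n : ℝ) - s - 3)⁻¹ := by
    rw [hR, integral_finsetSum _ fun i _ => (hint1 i).const_mul _, hτ, Finset.sum_mul]
    refine Finset.sum_congr rfl fun i _ => ?_
    rw [integral_const_mul, hval1]
  -- Only the diagonal terms are kept; the discarded ones are nonnegative because the weights are
  -- positive.
  have hQval : τ * (((n : ℝ) - s - 3) * ((n : ℝ) - s - 5))⁻¹ ≤ ∫ x, Q x ∂P := by
    have hdiag : Integrable (fun x => ∑ i, d i ^ 2 * H x i i ^ 2) P :=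
      integrable_finsetSum _ fun i _ => (hint2 i i).const_mul _
    have h1 : ∫ x, ∑ i, d i ^ 2 * H x i i ^ 2 ∂P
        = τ * (((n : ℝ) - s - 3) * ((n : ℝ) - s - 5))⁻¹ := by
      rw [integral_finsetSum _ fun i _ => (hint2 i i).const_mul _, hτ, Finset.sum_mul]
      refine Finset.sum_congr rfl fun i _ => ?_
      rw [integral_const_mul, hval2]
    rw [← h1]
    refine integral_mono hdiag hQint fun x => Finset.sum_le_sum fun i _ => ?_
    have h2 : d i ^ 2 * H x i i ^ 2 = d i * d i * H x i i ^ 2 := by ring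
    rw [h2]
    exact Finset.single_le_sum (f := fun j => d i * d j * H x i j ^ 2)
      (fun j _ => mul_nonneg (mul_nonneg (hd i).le (hd j).le) (sq_nonneg _)) (Finset.mem_univ i)
  have hpinv := ae_sampleLaw_pinv (μ := μ) (n := n) (by omega) hBV hCB hsymm
  have htrace : (fun x => (pinv (sampleCov x) ^ 2).trace) =ᵐ[P] fun x => (n : ℝ) ^ 2 * Q x := by
    filter_upwards [hpinv] with x hx
    have hsym : ((n : ℝ) • (scatter C x)⁻¹)ᵀ = (n : ℝ) • (scatter C x)⁻¹ := by
      have := (posSemidef_inv_scatter C x).1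
      rw [Matrix.IsHermitian, Matrix.conjTranspose_eq_transpose_of_trivial] at this
      rw [Matrix.transpose_smul, this]
    rw [hx, trace_conj_sq hCC hsym, hQ, Finset.mul_sum]
    refine Finset.sum_congr rfl fun i _ => ?_
    rw [Finset.mul_sum]
    refine Finset.sum_congr rfl fun j _ => ?_
    rw [Matrix.smul_apply, smul_eq_mul]
    ring
  have hτpos : 0 < τ :=
    Finset.sum_pos (fun i _ => pow_pos (hd i) 2) ⟨0, Finset.mem_univ _⟩
  refine ⟨(n : ℝ) ^ 2 * ∫ x, Q x ∂P, τ, hτpos, ?_, ?_, ?_, ?_⟩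
  · have h3 : 0 < (n : ℝ) - s - 3 := by linarith
    have h5 : 0 < (n : ℝ) - s - 5 := by linarith
    rw [mul_inv_le_iff₀ (mul_pos h3 h5)] at hQval
    refine hQval.trans_eq ?_
    push_cast
    field_simp
    ring
  · exact (hQint.const_mul _).congr htrace.symm
  · rw [integral_congr_ae htrace, integral_const_mul]
  · intro a
    have hloss : (fun x => frobeniusLoss (scaledPinv a x) (pinv V))
        =ᵐ[P] fun x => (a * n) ^ 2 * Q x - 2 * (a * n) * R x + τ := by
      filter_upwards [hpinv] with x hx
      have h1 : scaledPinv a x = C * ((a * n) • H x) * Cᵀ := by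
        rw [scaledPinv, hx, hH]
        simp only [Matrix.mul_smul, Matrix.smul_mul, smul_smul]
      rw [h1, hpinvV, frobeniusLoss_conj hCC]
      have h2 : ∀ i, ∑ j, d i * d j * (((a * n) • H x) i j
          - (1 : Matrix (Fin (s + 1)) (Fin (s + 1)) ℝ) i j) ^ 2
          = (a * n) ^ 2 * (∑ j, d i * d j * H x i j ^ 2) - 2 * (a * n) * (d i ^ 2 * H x i i)
            + d i ^ 2 := by
        intro i
        have h3 : ∀ j, d i * d j * (((a * n) • H x) i j
            - (1 : Matrix (Fin (s + 1)) (Fin (s + 1)) ℝ) i j) ^ 2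
            = (a * n) ^ 2 * (d i * d j * H x i j ^ 2)
              + if i = j then d i * d j * (1 - 2 * (a * n) * H x i j) else 0 := by
          intro j
          rw [Matrix.smul_apply, smul_eq_mul, Matrix.one_apply]
          split_ifs <;> ring
        simp_rw [h3]
        rw [Finset.sum_add_distrib, ← Finset.mul_sum, Finset.sum_ite_eq]
        simp only [Finset.mem_univ, if_true]
        ring
      simp_rw [h2]
      rw [Finset.sum_add_distrib, Finset.sum_sub_distrib, ← Finset.mul_sum, ← Finset.mul_sum]
    have hQR : Integrable (fun x => (a * n) ^ 2 * Q x - 2 * (a * n) * R x) P :=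
      (hQint.const_mul _).sub (hRint.const_mul _)
    have hint : Integrable (fun x => (a * n) ^ 2 * Q x - 2 * (a * n) * R x + τ) P :=
      hQR.add (integrable_const _)
    have hint' : Integrable (fun x => frobeniusLoss (scaledPinv a x) (pinv V)) P :=
      hint.congr hloss.symm
    have hnn : ∀ x : Sample n p, 0 ≤ frobeniusLoss (scaledPinv a x) (pinv V) := fun x => by
      rw [frobeniusLoss_eq_sum]
      positivity
    have hrisk : risk (n := n) (scaledPinv a) μ V
        = ENNReal.ofReal (∫ x, frobeniusLoss (scaledPinv a x) (pinv V) ∂P) := by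
      rw [risk, ofReal_integral_eq_lintegral_ofReal hint' (ae_of_all _ hnn)]
    refine ⟨by rw [hrisk]; exact ENNReal.ofReal_ne_top, ?_⟩
    rw [hrisk, ENNReal.toReal_ofReal (integral_nonneg hnn), integral_congr_ae hloss,
      integral_add hQR (integrable_const _),
      integral_sub (hQint.const_mul _) (hRint.const_mul _), integral_const_mul,
      integral_const_mul, hRval, integral_const]
    have h3 : (n : ℝ) - s - 3 ≠ 0 := by
      have : 0 < (n : ℝ) - s - 3 := by linarith
      exact this.ne'
    have h3' : (n : ℝ) - (s + 1) - 2 ≠ 0 := by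
      intro h; apply h3; linarith
    simp only [probReal_univ, one_smul]
    push_cast
    rw [show (n : ℝ) - (s + 1) - 2 = n - s - 3 by ring]
    field_simp

/-- Domination needs a parameter with strict inequality, hence a nonempty model. -/
theorem exists_isModelCov (hrp : r < p) : ∃ V : Matrix (Fin p) (Fin p) ℝ, IsModelCov r V := by
  refine ⟨Matrix.diagonal fun i => if (i : ℕ) < r then 1 else 0, ?_, ?_⟩
  · refine Matrix.PosSemidef.diagonal fun i => ?_
    simp only [Pi.zero_apply]
    split_ifs <;> norm_num
  · rw [Matrix.rank_diagonal, Fintype.card_subtype]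
    have : (Finset.univ.filter fun i : Fin p => (if (i : ℕ) < r then (1 : ℝ) else 0) ≠ 0)
        = Finset.univ.filter fun i : Fin p => (i : ℕ) < r := by
      ext i
      simp
    rw [this, Fin.card_filter_val_lt]
    omega

theorem dominates_of_toReal_risk_lt {a b : ℝ} (hrp : r < p)
    (hfin : ∀ (c : ℝ) μ V, IsModelCov r V → risk (n := n) (p := p) (scaledPinv c) μ V ≠ ⊤)
    (hlt : ∀ μ V, IsModelCov r V → (risk (n := n) (p := p) (scaledPinv a) μ V).toReal
      < (risk (n := n) (p := p) (scaledPinv b) μ V).toReal) :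
    Dominates (n := n) (p := p) r (scaledPinv a) (scaledPinv b) := by
  have h : ∀ μ V, IsModelCov r V → risk (n := n) (p := p) (scaledPinv a) μ V
      < risk (n := n) (p := p) (scaledPinv b) μ V := fun μ V hV =>
    (ENNReal.toReal_lt_toReal (hfin a μ V hV) (hfin b μ V hV)).1 (hlt μ V hV)
  obtain ⟨V, hV⟩ := exists_isModelCov hrp
  exact ⟨fun μ V hV => (h μ V hV).le, 0, V, hV, h 0 V hV⟩

end Risk

end SingularPrecision

/-! ### Algebra of the quadratic risk. -/

theorem proposition3 (n p r : ℕ) (hr : 1 ≤ r) (hrn : r + 5 ≤ n) (hrp : r < p) :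
    (∀ (μ : EuclideanSpace ℝ (Fin p)) (V : Matrix (Fin p) (Fin p) ℝ),
      SingularPrecision.IsModelCov r V →
        -- every risk and every expectation involved is finite
        (∀ a : ℝ, SingularPrecision.risk (n := n) (SingularPrecision.scaledPinv a) μ V ≠ ⊤) ∧
        Integrable (fun x => (SingularPrecision.pinv (SingularPrecision.sampleCov x) ^ 2).trace)
          (SingularPrecision.sampleLaw n μ V) ∧
        -- the upper bound on the risk
        (∀ a : ℝ, a ≤ ((n : ℝ) - r - 2) / n →
          (SingularPrecision.risk (n := n) (SingularPrecision.scaledPinv a) μ V).toReal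
            ≤ SingularPrecision.riskBound n r μ V a) ∧
        -- the unique minimizer of the upper bound
        (∀ a : ℝ, a ≠ ((n : ℝ) - r - 4) / n →
          SingularPrecision.riskBound n r μ V (((n : ℝ) - r - 4) / n)
            < SingularPrecision.riskBound n r μ V a)) ∧
    SingularPrecision.Dominates (n := n) (p := p) r
      (SingularPrecision.scaledPinv (((n : ℝ) - r - 4) / n))
      (SingularPrecision.scaledPinv (((n : ℝ) - r - 2) / n)) ∧
    SingularPrecision.Dominates (n := n) (p := p) r
      (SingularPrecision.scaledPinv (((n : ℝ) - r - 2) / n))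
      (SingularPrecision.scaledPinv 1) := by
  have hr0 : (1 : ℝ) ≤ r := by exact_mod_cast hr
  have hrn' : (r : ℝ) + 5 ≤ n := by exact_mod_cast hrn
  have hn : (0 : ℝ) < n := by linarith
  obtain ⟨c, hc⟩ : ∃ c : ℝ, c = ((n : ℝ) - r - 2) / n := ⟨_, rfl⟩
  obtain ⟨e, he⟩ : ∃ e : ℝ, e = (n : ℝ)⁻¹ := ⟨_, rfl⟩
  have he0 : 0 < e := by rw [he]; positivity
  have h4 : ((n : ℝ) - r - 4) / n = c - 2 * e := by rw [hc, he]; field_simp; ring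
  have h6 : ((n : ℝ) - r - 6) / n = c - 4 * e := by rw [hc, he]; field_simp; ring
  have hc2 : 0 < c - 2 * e := by rw [← h4]; exact div_pos (by linarith) hn
  have hc1 : c < 1 := by rw [hc, div_lt_one hn]; linarith
  have hc0 : 0 < c := by linarith
  have key : ∀ (μ : EuclideanSpace ℝ (Fin p)) (V : Matrix (Fin p) (Fin p) ℝ),
      SingularPrecision.IsModelCov r V → ∃ T q : ℝ, 0 < q ∧ 0 < T ∧
      q ≤ (c - 2 * e) * T ∧
      Integrable (fun x => (SingularPrecision.pinv (SingularPrecision.sampleCov x) ^ 2).trace)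
        (SingularPrecision.sampleLaw n μ V) ∧
      ∫ x, (SingularPrecision.pinv (SingularPrecision.sampleCov x) ^ 2).trace
        ∂(SingularPrecision.sampleLaw n μ V) = T ∧
      ∀ a : ℝ, SingularPrecision.risk (n := n) (SingularPrecision.scaledPinv a) μ V ≠ ⊤ ∧
        (SingularPrecision.risk (n := n) (SingularPrecision.scaledPinv a) μ V).toReal
          = a ^ 2 * T - 2 * a * q + c * q := by
    intro μ V hV
    obtain ⟨T, τ, hτ, hle, hint, hval, hrisk⟩ := SingularPrecision.exists_risk_eq hr hrn μ hV
    rw [← hc, h4] at hle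
    have hq : 0 < τ / c := div_pos hτ hc0
    have hqT : τ / c ≤ (c - 2 * e) * T := by
      rw [div_le_iff₀ hc0]
      linarith
    refine ⟨T, τ / c, hq, ?_, hqT, hint, hval, fun a => ⟨(hrisk a).1, ?_⟩⟩
    · by_contra hT
      have := mul_nonpos_of_nonneg_of_nonpos hc2.le (not_lt.1 hT)
      linarith
    · rw [(hrisk a).2, ← hc]
      field_simp
  refine ⟨fun μ V hV => ?_, ?_, ?_⟩
  · obtain ⟨T, q, hq, hT, hqT, hint, hval, hrisk⟩ := key μ V hV
    refine ⟨fun a => (hrisk a).1, hint, fun a ha => ?_, fun a ha => ?_⟩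
    · rw [SingularPrecision.riskBound, hval, h6]
      rw [← hc] at ha ⊢
      rw [(hrisk a).2, (hrisk c).2]
      -- The bound minus the risk is exactly `2 (c - a) ((c - 2e) T - q)`.
      nlinarith [mul_nonneg (sub_nonneg.2 ha) (sub_nonneg.2 hqT)]
    · rw [SingularPrecision.riskBound, SingularPrecision.riskBound, hval, h6]
      rw [h4] at ha ⊢
      rw [← hc]
      have hsq : 0 < (a - (c - 2 * e)) ^ 2 := by
        have := sub_ne_zero.2 ha
        positivity
      -- The two values of the bound differ by `(a - (c - 2e))² T`.
      nlinarith [mul_pos hsq hT]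
  · rw [h4, ← hc]
    refine SingularPrecision.dominates_of_toReal_risk_lt hrp
      (fun a μ V hV => by obtain ⟨T, q, -, -, -, -, -, hrisk⟩ := key μ V hV; exact (hrisk a).1)
      fun μ V hV => ?_
    obtain ⟨T, q, hq, hT, hqT, hint, hval, hrisk⟩ := key μ V hV
    rw [(hrisk _).2, (hrisk _).2]
    -- The risk gap is `4e ((c - e) T - q)`, at least `4 e² T`.
    nlinarith [mul_pos he0 hT, mul_nonneg he0.le (sub_nonneg.2 hqT), mul_pos (mul_pos he0 he0) hT]
  · rw [← hc]
    refine SingularPrecision.dominates_of_toReal_risk_lt hrp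
      (fun a μ V hV => by obtain ⟨T, q, -, -, -, -, -, hrisk⟩ := key μ V hV; exact (hrisk a).1)
      fun μ V hV => ?_
    obtain ⟨T, q, hq, hT, hqT, hint, hval, hrisk⟩ := key μ V hV
    rw [(hrisk _).2, (hrisk _).2]
    have h1 : 0 < 1 - c := sub_pos.2 hc1
    -- The risk gap is `(1 - c) ((1 + c) T - 2q)`, at least `(1 - c) (1 - c + 4e) T`.
    nlinarith [mul_pos h1 (mul_pos h1 hT), mul_pos h1 (mul_pos he0 hT),
      mul_nonneg h1.le (sub_nonneg.2 hqT)]
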